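/- Let $s,t\ge 2$ and $k\ge b\ge 1$ be integers, and put $$\varepsilon=\frac{s-1}{(s-1)k+b},\qquad K=\left\lceil 20\cdot 2^{\frac1{\varepsilon^2}+1}\right\rceil .$$ Let $S^s_{b,k}$ denote the spider with $s$ legs of lengths $b,k,\ldots,k$, i.e. the tree consisting of $s$ paths, one of length $b$ and $s-1$ of length $k$, that share one common end (the center) and are vertex-disjoint otherwise; its leaves are the $s$ other ends of these paths. Let $t*S^s_{b,k}$ be the union of $t$ labelled copies of $S^s_{b,k}$ which agree on the $s$ leaves and are pairwise vertex-disjoint outside the leaves. For a finite graph $G$ let $\delta(G)$ and $\Delta(G)$ be its minimum and maximum degree; $G$ is $K$-almost-regular if $\Delta(G)\le K\,\delta(G)$, and $G$ is $t*S^s_{b,k}$-free if it has no (not necessarily induced) subgraph isomorphic to $t*S^s_{b,k}$. Then there exist positive constants $n_0$ and $C$, depending only on $s,t,b,k$, such that for every integer $n\ge n_0$, every $n$-vertex, $K$-almost-regular, $t*S^s_{b,k}$-free graph $G$ satisfies $$\delta(G)< C\,n^{\frac{s-1}{(s-1)k+b}} .$$ -/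

import Mathlib

namespace ManyTuran

/-- The spider with length vector `ℓ`: the center is `none`, and `some ⟨i, j⟩` is the vertex of the
`i`-th leg at distance `j + 1` from the center, so the `i`-th leg is a path with `ℓ i` edges. -/
def spider {s : ℕ} (ℓ : Fin s → ℕ) : SimpleGraph (Option (Σ i : Fin s, Fin (ℓ i))) where
  Adj
    | none, none => False
    | none, some y => y.2.val = 0
    | some x, none => x.2.val = 0
    | some x, some y => x.1 = y.1 ∧ (x.2.val + 1 = y.2.val ∨ y.2.val + 1 = x.2.val)
  symm := ⟨by
    rintro (_ | x) (_ | y) h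
    · exact h
    · exact h
    · exact h
    · exact ⟨h.1.symm, h.2.symm⟩⟩
  loopless := ⟨by
    rintro (_ | x) h
    · exact h
    · have h2 := h.2
      omega⟩

/-- The leaves of the spider: the last vertices of its legs (all legs of positive length). -/
def spiderLeaves {s : ℕ} (ℓ : Fin s → ℕ) : Set (Option (Σ i : Fin s, Fin (ℓ i))) :=
  {v | ∃ x : (Σ i : Fin s, Fin (ℓ i)), v = some x ∧ x.2.val + 1 = ℓ x.1}

/-- The length vector `(b, k, …, k)` with `s` entries. -/
def lengthVector (s b k : ℕ) : Fin s → ℕ := fun i => if i.val = 0 then b else k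

open Classical in
/-- The `i`-th of `t` labelled copies of the vertex set `V`, the copies agreeing on `R` and being
pairwise disjoint outside `R`. -/
noncomputable def copy {V : Type*} (R : Set V) (t : ℕ) (i : Fin t) :
    V ↪ (↥R ⊕ (Fin t × ↥(Rᶜ))) where
  toFun v := if h : v ∈ R then Sum.inl ⟨v, h⟩ else Sum.inr (i, ⟨v, h⟩)
  inj' := by
    intro u v huv
    by_cases hu : u ∈ R <;> by_cases hv : v ∈ R <;> simpa [hu, hv] using huv

/-- The `t`-blowup of the graph `T` with root set `R`: the union of `t` labelled copies of `T` which
agree on `R` and are pairwise vertex-disjoint outside `R`. -/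
noncomputable def blowup {V : Type*} (T : SimpleGraph V) (R : Set V) (t : ℕ) :
    SimpleGraph (↥R ⊕ (Fin t × ↥(Rᶜ))) :=
  ⨆ i : Fin t, T.map (copy R t i)

/-- The graph `t * S^s_{b,k}`: the `t`-blowup of the `s`-legged spider with length vector
`(b, k, …, k)`, rooted at its leaves. -/
noncomputable def blownSpider (s t b k : ℕ) :=
  blowup (spider (lengthVector s b k)) (spiderLeaves (lengthVector s b k)) t

/-- `G` is `K`-almost-regular: its maximum degree is at most `K` times its minimum degree. -/
def IsAlmostRegular {V : Type*} [Fintype V] (G : SimpleGraph V) [DecidableRel G.Adj] (K : ℝ) :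
    Prop :=
  (G.maxDegree : ℝ) ≤ K * (G.minDegree : ℝ)

/-- The exponent `ε = (s - 1) / ((s - 1) k + b)`. -/
noncomputable def exponent (s b k : ℕ) : ℝ :=
  ((s : ℝ) - 1) / (((s : ℝ) - 1) * (k : ℝ) + (b : ℝ))

/-- The almost-regularity constant `K = ⌈20 · 2 ^ (1 / ε² + 1)⌉`. -/
noncomputable def regConst (ε : ℝ) : ℕ :=
  ⌈20 * (2 : ℝ) ^ (1 / ε ^ 2 + 1)⌉₊

end ManyTuran

/-! ### Cleaning, greedy choice and averaging -/

namespace ManyTuran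

open Finset
open scoped Classical

/-! Let m = (s-1)k + b be the number of edges of the spider. A graph of large minimum degree δ
contains at least a constant times n δ^m spiders, while there are only n^s tuples of leaves. If δ is
a large multiple of n^((s-1)/m), an average tuple is therefore joined by many spiders, and the
difficulty is to make t of them disjoint outside the leaves. It suffices to find a robust tuple
(`IsRobust`), since copies can then be chosen greedily (`IsRobust.isContained`). So the heart is
`exists_card_mul_pow_le`: without a robust tuple, n δ^m ≤ A n^s.

For this the set of all spiders is thinned out. Consider the restrictions of spiders to segments of
legs, to the two-edge paths around the center, and to subspiders, in this order and from small to
large. On half of the current spiders the restriction is rare (boundedly many have the same ends) or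
frequent (`exists_rare_or_frequent`). If rarity can always be achieved, its last instance, the whole
spider, bounds the number of spiders per tuple of leaves, which is the claim. Otherwise take the
first frequent restriction. As all smaller ones are rare, only boundedly many of those with given
ends pass through a given inner vertex, so some of them avoids any prescribed bounded set. By
almost-regularity these restrictions are also a positive proportion of the maximal possible number.
A robust tuple is built from them in two ways.

Paths of length l, 2 ≤ l ≤ k: `exists_dense_pair` finds vertices x i and a bipartite graph of large
minimum degree, every vertex of one side of which is joined to all x i by such paths. Walking in
this graph before taking these paths gives legs of the right lengths.

Subspiders: cleaning gives a flexible set (`exists_isFlexible`), in which a leaf can move by two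
steps at a time, to a new preceding vertex and on to a new leaf. This lengthens legs by even
amounts; an odd amount is reached by starting at the vertex before the leaf. That fails only when
two legs of length 1 both need it, as both would start at the center; rarity of the two-edge paths
excludes this case beforehand (`card_trunc_le_of_bend`). -/

theorem exists_subset_fibers_large {α β ι : Type*} [Fintype ι] [DecidableEq β]
    (π : ι → α → β) (θ : ι → ℕ)
    (S : Finset α) (h : ∑ i, θ i * #(S.image (π i)) < #S) :
    ∃ T ⊆ S, T.Nonempty ∧ ∀ i, ∀ a ∈ T, θ i ≤ #{a' ∈ T | π i a' = π i a} := by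
  induction S using Finset.strongInduction with
  | H S ih =>
    by_cases hS : ∀ i, ∀ a ∈ S, θ i ≤ #{a' ∈ S | π i a' = π i a}
    · exact ⟨S, Subset.rfl, card_pos.1 (by omega), hS⟩
    push Not at hS
    obtain ⟨i, a, ha, hlt⟩ := hS
    -- Removing a fibre with fewer than `θ i` elements also removes a value of `π i`, so both sides
    -- of `h` drop and the strict inequality survives.
    have hsub : S.filter (fun a' => ¬ π i a' = π i a) ⊂ S := by
      refine ⟨filter_subset _ _, fun hc => ?_⟩
      simpa using hc ha
    have hsplit := card_filter_add_card_filter_not (s := S) (fun a' => π i a' = π i a)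
    obtain ⟨T, hT, hne, hfib⟩ := ih _ hsub <| by
      have hle : ∑ i', θ i' * #((S.filter (fun a' => ¬ π i a' = π i a)).image (π i')) + θ i
          ≤ ∑ i', θ i' * #(S.image (π i')) := by
        rw [← Finset.add_sum_erase _ _ (mem_univ i), ← Finset.add_sum_erase (a := i)
          (f := fun i' => θ i' * #(S.image (π i'))) _ (mem_univ i)]
        have h1 : #((S.filter (fun a' => ¬ π i a' = π i a)).image (π i)) + 1 ≤
            #(S.image (π i)) := by
          rw [Nat.add_one_le_iff]
          refine card_lt_card ⟨image_subset_image (filter_subset _ _), fun hc => ?_⟩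
          obtain ⟨a', ha', he⟩ := mem_image.1 (hc (mem_image_of_mem _ ha))
          exact (mem_filter.1 ha').2 he
        have h2 : ∑ i' ∈ univ.erase i,
            θ i' * #((S.filter (fun a' => ¬ π i a' = π i a)).image (π i')) ≤
            ∑ i' ∈ univ.erase i, θ i' * #(S.image (π i')) :=
          sum_le_sum fun i' _ => Nat.mul_le_mul_left _
            (card_le_card (image_subset_image (filter_subset _ _)))
        have h3 := Nat.mul_le_mul_left (θ i) h1
        rw [mul_add, mul_one] at h3
        omega
      omega
    exact ⟨T, hT.trans (filter_subset _ _), hne, hfib⟩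

/-- Greedy choice of objects with pairwise disjoint supports. -/
theorem exists_disjoint_family {V ι α : Type*} (P : ι → α → Prop) (supp : ι → α → Finset V)
    (m N : ℕ) (hm : ∀ i a, #(supp i a) ≤ m) (I : Finset ι)
    (hP : ∀ i ∈ I, ∀ W : Finset V, #W ≤ N → ∃ a, P i a ∧ Disjoint (supp i a) W) (hα : Nonempty α)
    (X : Finset V) (hX : #X + m * #I ≤ N) :
    ∃ f : ι → α, (∀ i ∈ I, P i (f i) ∧ Disjoint (supp i (f i)) X) ∧
      ∀ i ∈ I, ∀ i' ∈ I, i ≠ i' → Disjoint (supp i (f i)) (supp i' (f i')) := by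
  induction I using Finset.induction_on generalizing X with
  | empty => exact ⟨fun _ => hα.some, by simp, by simp⟩
  | insert a I ha ih =>
    rw [card_insert_of_notMem ha, mul_add] at hX
    obtain ⟨b, hb, hbX⟩ := hP a (mem_insert_self _ _) X (by omega)
    have hle : #(X ∪ supp a b) ≤ #X + m := (card_union_le _ _).trans (by have := hm a b; omega)
    obtain ⟨f, hf, hf'⟩ := ih (fun i hi => hP i (mem_insert_of_mem hi)) (X ∪ supp a b) (by omega)
    have hne : ∀ i ∈ I, i ≠ a := fun i hi h => ha (h ▸ hi)
    refine ⟨Function.update f a b, ?_, ?_⟩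
    · intro i hi
      rcases mem_insert.1 hi with rfl | hi
      · simpa using ⟨hb, hbX⟩
      · rw [Function.update_of_ne (hne i hi)]
        exact ⟨(hf i hi).1, (disjoint_union_right.1 (hf i hi).2).1⟩
    · intro i hi i' hi' hii
      rcases mem_insert.1 hi with rfl | hi <;> rcases mem_insert.1 hi' with h | hi'
      · exact absurd h.symm hii
      · rw [Function.update_self, Function.update_of_ne (hne i' hi')]
        exact (disjoint_union_right.1 (hf i' hi').2).2.symm
      · rw [h, Function.update_self, Function.update_of_ne (hne i hi)]
        exact (disjoint_union_right.1 (hf i hi).2).2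
      · rw [Function.update_of_ne (hne i hi), Function.update_of_ne (hne i' hi')]
        exact hf' i hi i' hi' hii

/-- If every vertex on the left has many neighbours on the right, then some `m` vertices on the
right have many common neighbours on the left. -/
theorem exists_common_neighbors {α β : Type*} (R : α → β → Prop) (X : Finset β) (θ m : ℕ)
    (Q : Finset α) (hQ : ∀ q ∈ Q, θ + m ≤ #{x ∈ X | R q x}) (hne : Q.Nonempty) (hθ : 0 < θ) :
    ∃ x : Fin m → β, Function.Injective x ∧
      #Q * θ ^ m ≤ #{q ∈ Q | ∀ i, R q (x i)} * #X ^ m := by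
  suffices H : ∀ r ≤ m, ∃ x : Fin r → β, Function.Injective x ∧
      #Q * θ ^ r ≤ #{q ∈ Q | ∀ i, R q (x i)} * #X ^ r from H m le_rfl
  intro r
  induction r with
  | zero => exact fun _ => ⟨Fin.elim0, fun i => i.elim0, by simp⟩
  | succ r ih =>
    intro hr
    obtain ⟨x, hx, hle⟩ := ih (by omega)
    set Q' := Q.filter (fun q => ∀ i, R q (x i)) with hQ'
    set X' := X \ univ.image x
    have hpos : 0 < #Q' := by
      have : 0 < #Q * θ ^ r := Nat.mul_pos (card_pos.2 hne) (pow_pos hθ _)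
      exact Nat.pos_of_mul_pos_right (this.trans_le hle)
    -- The summand `m` in the degree hypothesis pays for the vertices already chosen.
    have hdeg : ∀ q ∈ Q', θ ≤ #{y ∈ X' | R q y} := by
      intro q hq
      have h1 := hQ q (mem_filter.1 hq).1
      have h2 : #{y ∈ X | R q y} ≤ #{y ∈ X' | R q y} + r := by
        calc #{y ∈ X | R q y} ≤ #({y ∈ X' | R q y} ∪ univ.image x) := by
              apply card_le_card
              intro y hy
              simp only [mem_filter] at hy
              by_cases hyx : y ∈ univ.image x
              · exact mem_union_right _ hyx
              · exact mem_union_left _ (mem_filter.2 ⟨mem_sdiff.2 ⟨hy.1, hyx⟩, hy.2⟩)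
          _ ≤ _ := (card_union_le _ _).trans (Nat.add_le_add_left
              (card_image_le.trans (by simp)) _)
      omega
    have hcount : #Q' * θ ≤ ∑ y ∈ X', #{q ∈ Q' | R q y} := by
      have h1 := card_nsmul_le_sum Q' (fun q => #{y ∈ X' | R q y}) θ hdeg
      exact h1.trans (sum_card_bipartiteAbove_eq_sum_card_bipartiteBelow R).le
    have hX'ne : X'.Nonempty := by
      rcases X'.eq_empty_or_nonempty with h | h
      · rw [h, sum_empty] at hcount
        have := Nat.mul_pos hpos hθ
        omega
      · exact h
    -- The best new vertex keeps at least the fraction θ / #X of `Q'`, by double counting.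
    obtain ⟨y, hy, hmax⟩ := exists_max_image X' (fun y => #{q ∈ Q' | R q y}) hX'ne
    have hy2 : #Q' * θ ≤ #{q ∈ Q' | R q y} * #X := by
      refine hcount.trans ((sum_le_card_nsmul _ _ _ hmax).trans ?_)
      rw [smul_eq_mul, mul_comm]
      exact Nat.mul_le_mul_left _ (card_le_card sdiff_subset)
    refine ⟨Fin.snoc x y, ?_, ?_⟩
    · rw [Fin.snoc_injective_iff]
      refine ⟨hx, ?_⟩
      rintro ⟨i, rfl⟩
      exact (mem_sdiff.1 hy).2 (mem_image_of_mem _ (mem_univ _))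
    · have he : Q.filter (fun q => ∀ i, R q (Fin.snoc (α := fun _ => β) x y i)) =
          Q'.filter (fun q => R q y) := by
        ext q
        simp [hQ', Fin.forall_fin_succ', and_assoc]
      rw [he, pow_succ, pow_succ, ← mul_assoc]
      calc #Q * θ ^ r * θ ≤ #Q' * #X ^ r * θ := Nat.mul_le_mul_right _ hle
        _ = #Q' * θ * #X ^ r := by ring
        _ ≤ #{q ∈ Q' | R q y} * #X * #X ^ r := Nat.mul_le_mul_right _ hy2
        _ = _ := by ring

/-- Refining a finite set of objects so that it satisfies finitely many monotone conditions, each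
of which costs a factor of two and may rely on the conditions of smaller rank. -/
theorem exists_refinement {α ι : Type*} [Fintype ι] (rank : ι → ℕ) (P : ι → Finset α → Prop)
    (hP : ∀ i S T, S ⊆ T → P i T → P i S) (S₀ : Finset α)
    (h : ∀ i, ∀ S ⊆ S₀, #S₀ ≤ 2 ^ Fintype.card ι * #S → (∀ i', rank i' < rank i → P i' S) →
      ∃ T ⊆ S, #S ≤ 2 * #T ∧ P i T) :
    ∃ S ⊆ S₀, #S₀ ≤ 2 ^ Fintype.card ι * #S ∧ ∀ i, P i S := by
  suffices H : ∀ I : Finset ι, (∀ i ∈ I, ∀ i', rank i' < rank i → i' ∈ I) →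
      ∃ S ⊆ S₀, #S₀ ≤ 2 ^ #I * #S ∧ ∀ i ∈ I, P i S by
    obtain ⟨S, h1, h2, h3⟩ := H univ (by simp)
    exact ⟨S, h1, by simpa using h2, by simpa using h3⟩
  intro I
  -- The conditions are imposed by increasing rank, so those of smaller rank hold already; they
  -- survive later steps because they pass to subsets.
  induction I using Finset.induction_on_max_value rank with
  | empty => exact fun _ => ⟨S₀, Subset.rfl, by simp, by simp⟩
  | insert a I ha hmax ih =>
    intro hI
    obtain ⟨S, h1, h2, h3⟩ := ih (fun i hi i' hi' => by
      have hlt := hi'.trans_le (hmax i hi)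
      rcases mem_insert.1 (hI i (mem_insert_of_mem hi) i' hi') with rfl | h
      · exact absurd hlt (lt_irrefl _)
      · exact h)
    obtain ⟨T, hT, hc, hPT⟩ := h a S h1
      (h2.trans (Nat.mul_le_mul_right _ (Nat.pow_le_pow_right (by norm_num) (card_le_univ _))))
      (fun i' hi' => h3 i' ((mem_insert.1 (hI a (mem_insert_self _ _) i' hi')).resolve_left
        (fun e => by simp [e] at hi')))
    refine ⟨T, hT.trans h1, ?_, ?_⟩
    · rw [card_insert_of_notMem ha, pow_succ, mul_assoc]
      exact h2.trans (Nat.mul_le_mul_left _ hc)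
    · intro i hi
      rcases mem_insert.1 hi with rfl | hi
      · exact hPT
      · exact hP i T S hT (h3 i hi)

variable {V : Type*}

/-- A path in `G` of length `r`, given as the values at `0, …, r` of a function on `ℕ`. -/
structure IsPathOn (G : SimpleGraph V) (r : ℕ) (q : ℕ → V) : Prop where
  adj : ∀ a < r, G.Adj (q a) (q (a + 1))
  inj : ∀ a a', a ≤ r → a' ≤ r → q a = q a' → a = a'

/-- Each step can avoid `N` vertices, hence also the part of the path already built. `M d x` says
that the state `x` is admissible with the countdown at `d`. States are kept apart from their
positions so that a state can carry a whole spider. -/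
theorem exists_path_of_states (G : SimpleGraph V) {σ : Type*} (pos : σ → V) (M : ℕ → σ → Prop)
    (N : ℕ) (step : ∀ d x, M (d + 1) x → ∀ W : Finset V, #W ≤ N →
      ∃ y, M d y ∧ G.Adj (pos x) (pos y) ∧ pos y ∉ W)
    (r d : ℕ) (x : σ) (hx : M (d + r) x) (W : Finset V) (hW : #W + r ≤ N) :
    ∃ (q : ℕ → V) (y : σ), M d y ∧ q 0 = pos x ∧ q r = pos y ∧ IsPathOn G r q ∧
      ∀ a, 0 < a → a ≤ r → q a ∉ W := by
  induction r generalizing x W with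
  | zero =>
    exact ⟨fun _ => pos x, x, hx, rfl, rfl, ⟨by simp, by intros; omega⟩, by intros; omega⟩
  | succ r ih =>
    have hc : #(insert (pos x) W) ≤ #W + 1 := card_insert_le _ _
    obtain ⟨y, hy, hadj, hyW⟩ := step (d + r) x hx (insert (pos x) W) (by omega)
    obtain ⟨q, z, hz, h0, hr, hq, hqW⟩ := ih y hy (insert (pos x) W) (by omega)
    have hne : ∀ a, a ≤ r → q a ∉ insert (pos x) W := by
      intro a ha
      rcases Nat.eq_zero_or_pos a with rfl | h
      · rwa [h0]
      · exact hqW a h ha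
    refine ⟨fun a => Nat.casesOn a (pos x) q, z, hz, rfl, hr, ⟨?_, ?_⟩, ?_⟩
    · rintro (_ | a) ha
      · simpa [h0] using hadj
      · exact hq.adj a (by omega)
    · rintro (_ | a) (_ | a') ha ha' he
      · rfl
      · exact absurd (mem_insert.2 (Or.inl he.symm)) (hne a' (by omega))
      · exact absurd (mem_insert.2 (Or.inl he)) (hne a (by omega))
      · rw [hq.inj a a' (by omega) (by omega) he]
    · rintro (_ | a) h0 ha
      · omega
      · exact fun hm => hne a (by omega) (mem_insert_of_mem hm)

end ManyTuran

/-! ### From robust leaves to blown-up spiders -/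

namespace ManyTuran

open Finset
open scoped Classical

variable {V : Type*}

/-- The copies of `T` are embedded greedily with common values on `R`, each avoiding the non-root
vertices of the others; all of them together have at most `t * Fintype.card W` vertices. -/
theorem blowup_isContained {W : Type*} [Fintype W] (T : SimpleGraph W) (R : Set W) (t : ℕ)
    (G : SimpleGraph V) (ht : 0 < t) (x : W → V)
    (h : ∀ X : Finset V, #X ≤ t * Fintype.card W → ∃ φ : W → V, Function.Injective φ ∧
      (∀ u v, T.Adj u v → G.Adj (φ u) (φ v)) ∧ (∀ u ∈ R, φ u = x u) ∧ ∀ u ∉ R, φ u ∉ X) :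
    (blowup T R t).IsContained G := by
  obtain ⟨φ, hφ, hdisj⟩ := exists_disjoint_family (ι := Fin t)
    (fun _ (φ : W → V) => Function.Injective φ ∧
      (∀ u v, T.Adj u v → G.Adj (φ u) (φ v)) ∧ (∀ u ∈ R, φ u = x u))
    (fun _ φ => (univ.filter (fun u => u ∉ R)).image φ) (Fintype.card W) (t * Fintype.card W)
    (fun _ φ => card_image_le.trans (card_le_univ _)) univ
    (by
      intro _ _ X hX
      obtain ⟨φ, h1, h2, h3, h4⟩ := h X hX
      refine ⟨φ, ⟨h1, h2, h3⟩, ?_⟩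
      rw [disjoint_left]
      intro v hv
      obtain ⟨u, hu, rfl⟩ := mem_image.1 hv
      exact h4 u (mem_filter.1 hu).2)
    ⟨x⟩ ∅ (by simp [mul_comm])
  have hne : ∀ j j' u u', u ∉ R → u' ∉ R → φ j u = φ j' u' → j = j' ∧ u = u' := by
    intro j j' u u' hu hu' he
    by_cases hj : j = j'
    · subst hj
      exact ⟨rfl, (hφ j (mem_univ _)).1.1 he⟩
    · have := disjoint_left.1 (hdisj j (mem_univ _) j' (mem_univ _) hj)
        (mem_image_of_mem _ (mem_filter.2 ⟨mem_univ _, hu⟩))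
      rw [he] at this
      exact absurd (mem_image_of_mem (φ j') (mem_filter.2 ⟨mem_univ u', hu'⟩)) this
  let F : ↥R ⊕ (Fin t × ↥(Rᶜ)) → V := Sum.elim (fun r => x r) (fun a => φ a.1 a.2)
  have hF : ∀ j u, F (copy R t j u) = φ j u := by
    intro j u
    have he : copy R t j u = if h : u ∈ R then Sum.inl ⟨u, h⟩ else Sum.inr (j, ⟨u, h⟩) := rfl
    by_cases hu : u ∈ R
    · rw [he, dif_pos hu]
      exact ((hφ j (mem_univ _)).1.2.2 u hu).symm
    · rw [he, dif_neg hu]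
      rfl
  -- A root lies in every copy, so it differs from any non-root vertex by injectivity of the copy
  -- containing the latter.
  have hR : ∀ j, ∀ r : R, F (Sum.inl r) = φ j r := fun j r =>
    ((hφ j (mem_univ _)).1.2.2 r r.2).symm
  have hinj : Function.Injective F := by
    rintro (a | a) (b | b) hab
    · rw [hR ⟨0, ht⟩, hR ⟨0, ht⟩] at hab
      exact congrArg Sum.inl (Subtype.ext ((hφ _ (mem_univ _)).1.1 hab))
    · rw [hR b.1] at hab
      exact absurd ((hφ _ (mem_univ _)).1.1 hab ▸ a.2) b.2.2
    · rw [hR a.1] at hab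
      exact absurd ((hφ _ (mem_univ _)).1.1 hab.symm ▸ b.2) a.2.2
    · obtain ⟨h1, h2⟩ := hne _ _ _ _ a.2.2 b.2.2 hab
      exact congrArg Sum.inr (Prod.ext h1 (Subtype.ext h2))
  refine ⟨⟨⟨F, ?_⟩, hinj⟩⟩
  intro a b hab
  simp only [blowup, SimpleGraph.iSup_adj, SimpleGraph.map_adj] at hab
  obtain ⟨j, u, v, huv, rfl, rfl⟩ := hab
  rw [hF, hF]
  exact (hφ j (mem_univ _)).1.2.1 u v huv

/-- An embedding into `G` of the spider with length vector `j`; `p i d` is the image of the vertex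
of the `i`-th leg at distance `d` from the center, and `p i` is constant beyond the leaf. -/
structure IsSpider {s : ℕ} (G : SimpleGraph V) (j : Fin s → ℕ) (p : Fin s → ℕ → V) : Prop where
  center : ∀ i i', p i 0 = p i' 0
  adj : ∀ i d, d < j i → G.Adj (p i d) (p i (d + 1))
  inj : ∀ i i' d d', d ≤ j i → d' ≤ j i' → p i d = p i' d' → d = d' ∧ (d = 0 ∨ i = i')
  stab : ∀ i d, p i d = p i (min d (j i))

/-- The vertices `x i` are the leaves of spiders avoiding any given `N` vertices. -/
def IsRobust {s : ℕ} (G : SimpleGraph V) (L : Fin s → ℕ) (N : ℕ) (x : Fin s → V) : Prop :=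
  ∀ X : Finset V, #X ≤ N → ∃ p, IsSpider G L p ∧ (∀ i, p i (L i) = x i) ∧
    ∀ i d, d < L i → p i d ∉ X

theorem IsRobust.isContained {s : ℕ} {G : SimpleGraph V} {L : Fin s → ℕ} {N t : ℕ} {x : Fin s → V}
    (h : IsRobust G L N x) (hN : t * (∑ i, L i + 1) ≤ N)
    (ht : 0 < t) (hs : 0 < s) (hL : ∀ i, 0 < L i) :
    (blowup (spider L) (spiderLeaves L) t).IsContained G := by
  have hcard : Fintype.card (Option (Σ i : Fin s, Fin (L i))) = ∑ i, L i + 1 := by simp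
  refine blowup_isContained _ _ _ _ ht (fun u => Option.elim u (x ⟨0, hs⟩) (fun y => x y.1)) ?_
  intro X hX
  rw [hcard] at hX
  obtain ⟨p, hp, hx, hX⟩ := h X (hX.trans hN)
  refine ⟨fun u => Option.elim u (p ⟨0, hs⟩ 0) (fun y => p y.1 (y.2 + 1)), ?_, ?_, ?_, ?_⟩
  · rintro (_ | ⟨i, a, ha⟩) (_ | ⟨i', a', ha'⟩) he
    · rfl
    · have := (hp.inj _ _ _ _ (by omega) (by simp; omega) he).1
      simp at this
    · have := (hp.inj _ _ _ _ (by simp; omega) (by omega) he).1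
      simp at this
    · obtain ⟨h1, h2⟩ := hp.inj _ _ _ _ (by simp; omega) (by simp; omega) he
      simp at h1 h2
      subst h2
      subst h1
      rfl
  · rintro (_ | ⟨i, a⟩) (_ | ⟨i', a'⟩) hadj
    · exact hadj.elim
    · have h0 : a'.val = 0 := hadj
      have := hp.adj i' 0 (by omega)
      simp only [Option.elim, h0]
      rw [hp.center _ i']
      exact this
    · have h0 : a.val = 0 := hadj
      have := hp.adj i 0 (by omega)
      simp only [Option.elim, h0]
      rw [hp.center _ i]
      exact this.symm
    · obtain ⟨h1, h2⟩ := hadj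
      dsimp only at h1 h2
      subst h1
      rcases h2 with h2 | h2
      · simp only [Option.elim, ← h2]
        exact hp.adj i _ (by omega)
      · simp only [Option.elim, ← h2]
        exact (hp.adj i _ (by omega)).symm
  · rintro u ⟨⟨i, a⟩, rfl, ha⟩
    simp only [Option.elim] at ha ⊢
    rw [ha, hx]
  · rintro (_ | ⟨i, a⟩) hu
    · simp only [Option.elim]
      exact hX _ 0 (hL _)
    · apply hX
      by_contra hc
      exact hu ⟨_, rfl, by have := a.2; simp only at hc ⊢; omega⟩

end ManyTuran

/-! ### Subspiders -/

namespace ManyTuran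

open Finset
open scoped Classical

variable {V : Type*} {s : ℕ}

/-- The subspider whose `i`-th leg has length `j i`. -/
def trunc (j : Fin s → ℕ) (p : Fin s → ℕ → V) : Fin s → ℕ → V := fun i d => p i (min d (j i))

theorem trunc_trunc {j j' : Fin s → ℕ} (h : ∀ i, j i ≤ j' i) (p : Fin s → ℕ → V) :
    trunc j (trunc j' p) = trunc j p := by
  funext i d
  have := h i
  simp only [trunc]
  congr 1
  omega

theorem IsSpider.trunc_self {G : SimpleGraph V} {j : Fin s → ℕ} {p : Fin s → ℕ → V}
    (h : IsSpider G j p) : trunc j p = p := by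
  funext i d
  exact (h.stab i d).symm

theorem IsSpider.trunc {G : SimpleGraph V} {j j' : Fin s → ℕ} {p : Fin s → ℕ → V}
    (h : IsSpider G j' p) (hle : ∀ i, j i ≤ j' i) : IsSpider G j (trunc j p) where
  center i i' := by simpa [ManyTuran.trunc] using h.center i i'
  adj i d hd := by
    have := hle i
    have h1 : min d (j i) = d := by omega
    have h2 : min (d + 1) (j i) = d + 1 := by omega
    simp only [ManyTuran.trunc, h1, h2]
    exact h.adj i d (by omega)
  inj i i' d d' hd hd' he := by
    simp only [ManyTuran.trunc, min_eq_left hd, min_eq_left hd'] at he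
    exact h.inj i i' d d' (hd.trans (hle i)) (hd'.trans (hle i')) he
  stab i d := by simp [ManyTuran.trunc]

/-- The vertices of a spider. -/
noncomputable def spiderVerts (j : Fin s → ℕ) (p : Fin s → ℕ → V) : Finset V :=
  univ.biUnion fun i => (range (j i + 1)).image (p i)

theorem mem_spiderVerts {j : Fin s → ℕ} {p : Fin s → ℕ → V} {i : Fin s} {d : ℕ} (hd : d ≤ j i) :
    p i d ∈ spiderVerts j p :=
  mem_biUnion.2 ⟨i, mem_univ _, mem_image_of_mem _ (mem_range.2 (by omega))⟩

theorem card_spiderVerts_le (j : Fin s → ℕ) (p : Fin s → ℕ → V) :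
    #(spiderVerts j p) ≤ ∑ i, j i + s := by
  refine card_biUnion_le.trans ?_
  calc ∑ i, #((range (j i + 1)).image (p i)) ≤ ∑ i, (j i + 1) :=
        sum_le_sum fun i _ => card_image_le.trans (by simp)
    _ = _ := by simp [sum_add_distrib]

/-- Lengthening the `i`-th leg of a spider by one vertex. -/
theorem IsSpider.extend {G : SimpleGraph V} {j : Fin s → ℕ} {p : Fin s → ℕ → V}
    (h : IsSpider G j p) (i : Fin s) {u : V} (hu : G.Adj (p i (j i)) u)
    (hu' : u ∉ spiderVerts j p) :
    IsSpider G (Function.update j i (j i + 1))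
      (Function.update p i (fun d => if d ≤ j i then p i d else u)) where
  center a a' := by
    have : ∀ a, (Function.update p i (fun d => if d ≤ j i then p i d else u)) a 0 = p a 0 := by
      intro a
      by_cases ha : a = i
      · subst ha; simp
      · simp [ha]
    rw [this, this]
    exact h.center a a'
  adj a d hd := by
    by_cases ha : a = i
    · subst ha
      simp only [Function.update_self] at hd ⊢
      rw [if_pos (by omega)]
      split_ifs with h1
      · exact h.adj a d (by omega)
      · have : d = j a := by omega
        subst this
        exact hu
    · simp only [Function.update_of_ne ha] at hd ⊢
      exact h.adj a d hd
  inj a a' d d' hd hd' he := by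
    have key : ∀ a d, d ≤ (Function.update j i (j i + 1)) a →
        (Function.update p i (fun d => if d ≤ j i then p i d else u)) a d =
          if a = i ∧ d = j i + 1 then u else p a d := by
      intro a d hd
      by_cases ha : a = i
      · subst ha
        simp only [Function.update_self] at hd ⊢
        by_cases hd1 : d ≤ j a
        · rw [if_pos hd1, if_neg (by omega)]
        · rw [if_neg hd1, if_pos ⟨trivial, by omega⟩]
      · simp [ha]
    have key2 : ∀ a d, d ≤ (Function.update j i (j i + 1)) a → ¬ (a = i ∧ d = j i + 1) →
        d ≤ j a := by
      intro a d hd hn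
      by_cases ha : a = i
      · subst ha
        simp only [Function.update_self] at hd
        by_contra hc
        exact hn ⟨rfl, by omega⟩
      · simpa [ha] using hd
    rw [key a d hd, key a' d' hd'] at he
    by_cases h1 : a = i ∧ d = j i + 1 <;> by_cases h2 : a' = i ∧ d' = j i + 1
    · exact ⟨h1.2.trans h2.2.symm, Or.inr (h1.1.trans h2.1.symm)⟩
    · rw [if_pos h1, if_neg h2] at he
      exact absurd (he ▸ mem_spiderVerts (key2 _ _ hd' h2)) hu'
    · rw [if_neg h1, if_pos h2] at he
      exact absurd (he ▸ mem_spiderVerts (key2 _ _ hd h1)) hu'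
    · rw [if_neg h1, if_neg h2] at he
      exact h.inj _ _ _ _ (key2 _ _ hd h1) (key2 _ _ hd' h2) he
  stab a d := by
    by_cases ha : a = i
    · subst ha
      simp only [Function.update_self]
      by_cases hd : d ≤ j a
      · rw [min_eq_left (by omega)]
      · rw [min_eq_right (by omega), if_neg hd, if_neg (by omega)]
    · simp only [Function.update_of_ne ha]
      exact h.stab a d

theorem sum_add_one_of_update {j j' : Fin s → ℕ} {i : Fin s} (h : j i + 1 = j' i)
    (h' : ∀ a, a ≠ i → j a = j' a) : ∑ a, j a + 1 = ∑ a, j' a := by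
  have e1 : j i + ∑ a ∈ univ.erase i, j a = ∑ a, j a := add_sum_erase _ _ (mem_univ i)
  have e2 : j' i + ∑ a ∈ univ.erase i, j' a = ∑ a, j' a := add_sum_erase _ _ (mem_univ i)
  have e3 : ∑ a ∈ univ.erase i, j a = ∑ a ∈ univ.erase i, j' a :=
    sum_congr rfl fun a ha => h' a (ne_of_mem_erase ha)
  omega

/-! ### Counting spiders, walks and their restrictions -/

section Counting

variable [Fintype V] (G : SimpleGraph V)

/-- By `stab` a spider has no free values beyond its leaves, so finitely many values determine it.
-/
theorem finite_isSpider (j : Fin s → ℕ) : {p : Fin s → ℕ → V | IsSpider G j p}.Finite := by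
  refine Set.Finite.of_injOn
    (f := fun p (i : Fin s) (d : Fin (∑ i, j i + 1)) => p i d)
    (t := (Set.univ : Set (Fin s → Fin (∑ i, j i + 1) → V)))
    (fun _ _ => Set.mem_univ _) ?_ Set.finite_univ
  intro p hp q hq he
  funext i d
  have h1 : j i ≤ ∑ i, j i := single_le_sum (f := j) (fun _ _ => Nat.zero_le _) (mem_univ i)
  rw [hp.stab, hq.stab]
  exact congrFun (congrFun he i) ⟨min d (j i), by omega⟩

/-- All spiders in `G` with length vector `j`. -/
noncomputable def spiders (j : Fin s → ℕ) : Finset (Fin s → ℕ → V) :=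
  (finite_isSpider G j).toFinset

variable {G}

theorem mem_spiders {j : Fin s → ℕ} {p : Fin s → ℕ → V} :
    p ∈ spiders G j ↔ IsSpider G j p := by
  simp [spiders]

theorem card_image_trunc_zero_le (hs : 0 < s) (j : Fin s → ℕ) (S : Finset (Fin s → ℕ → V))
    (hS : ∀ p ∈ S, IsSpider G j p) : #(S.image (trunc fun _ => 0)) ≤ Fintype.card V := by
  refine card_le_card_of_injOn (t := univ) (fun p => p ⟨0, hs⟩ 0) (fun _ _ => mem_univ _) ?_
  intro p hp q hq he
  obtain ⟨p, hp', rfl⟩ := mem_image.1 hp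
  obtain ⟨q, hq', rfl⟩ := mem_image.1 hq
  funext i d
  simp only [trunc, Nat.min_zero] at he ⊢
  rw [(hS p hp').center i ⟨0, hs⟩, (hS q hq').center i ⟨0, hs⟩]
  exact he

variable [DecidableRel G.Adj]

/-- The `m` missing vertices are restored one at a time, each among at most `Δ` neighbours of a
known vertex. -/
theorem card_le_card_image_trunc_mul {Δ : ℕ} (hΔ : ∀ v, G.degree v ≤ Δ) (m : ℕ)
    (j j' : Fin s → ℕ) (hle : ∀ i, j i ≤ j' i) (hm : ∑ i, j' i = ∑ i, j i + m)
    (S : Finset (Fin s → ℕ → V)) (hS : ∀ p ∈ S, IsSpider G j' p) :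
    #S ≤ #(S.image (trunc j)) * Δ ^ m := by
  induction m generalizing j' S with
  | zero =>
    have : j = j' := by
      funext i
      exact (sum_eq_sum_iff_of_le (fun i _ => hle i)).1 (by omega) i (mem_univ i)
    subst this
    have : S.image (trunc j) = S := by
      conv_rhs => rw [← image_id (s := S)]
      exact image_congr fun p hp => (hS p hp).trunc_self
    simp [this]
  | succ m ih =>
    obtain ⟨i, hi⟩ : ∃ i, j i < j' i := by
      by_contra! hc
      have := sum_le_sum fun i (_ : i ∈ univ) => hc i
      omega
    set j1 := Function.update j' i (j' i - 1) with hj1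
    have hj1i : j1 i + 1 = j' i := by simp [hj1]; omega
    have hj1' : ∀ a, a ≠ i → j1 a = j' a := fun a ha => by simp [hj1, ha]
    have hle1 : ∀ a, j a ≤ j1 a := by
      intro a
      by_cases ha : a = i
      · subst ha; omega
      · rw [hj1' a ha]; exact hle a
    have hle2 : ∀ a, j1 a ≤ j' a := by
      intro a
      by_cases ha : a = i
      · subst ha; omega
      · rw [hj1' a ha]
    have hsum : ∑ a, j1 a + 1 = ∑ a, j' a := sum_add_one_of_update hj1i hj1'
    have hstep : #S ≤ Δ * #(S.image (trunc j1)) := by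
      refine card_le_mul_card_image S Δ fun b _ => ?_
      refine (card_le_card_of_injOn (t := G.neighborFinset (b i (j1 i)))
        (fun p => p i (j' i)) ?_ ?_).trans (hΔ _)
      · intro p hp
        obtain ⟨hp', rfl⟩ := mem_filter.1 hp
        have := (hS p hp').adj i (j1 i) (by omega)
        rw [hj1i] at this
        rw [mem_coe, SimpleGraph.mem_neighborFinset, trunc, min_self]
        exact this
      · intro p hp q hq he
        obtain ⟨hp', hpb⟩ := mem_filter.1 hp
        obtain ⟨hq', hqb⟩ := mem_filter.1 hq
        funext a d
        rw [(hS p hp').stab a d, (hS q hq').stab a d]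
        have hpq := congrFun (congrFun (hpb.trans hqb.symm) a) (min d (j' a))
        simp only [trunc] at hpq
        by_cases ha : a = i
        · subst ha
          by_cases hd : d < j' a
          · rw [min_eq_left hd.le, min_eq_left (by omega)] at hpq
            rw [min_eq_left hd.le]
            exact hpq
          · rw [min_eq_right (by omega)]
            exact he
        · rw [hj1' a ha] at hpq
          simpa using hpq
    refine hstep.trans ?_
    have := ih j1 hle1 (by omega) (S.image (trunc j1)) (by
      intro p hp
      obtain ⟨q, hq, rfl⟩ := mem_image.1 hp
      exact (hS q hq).trunc hle2)
    rw [image_image, show trunc j ∘ trunc j1 = trunc (V := V) j from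
      funext (trunc_trunc hle1)] at this
    calc Δ * #(S.image (trunc j1)) ≤ Δ * (#(S.image (trunc j)) * Δ ^ m) :=
          Nat.mul_le_mul_left _ this
      _ = _ := by ring

theorem card_spiders_le {Δ : ℕ} (hΔ : ∀ v, G.degree v ≤ Δ) (hs : 0 < s) (j : Fin s → ℕ)
    (S : Finset (Fin s → ℕ → V)) (hS : ∀ p ∈ S, IsSpider G j p) :
    #S ≤ Fintype.card V * Δ ^ ∑ i, j i :=
  (card_le_card_image_trunc_mul hΔ (∑ i, j i) (fun _ => 0) j (by simp) (by simp) S hS).trans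
    (Nat.mul_le_mul_right _ (card_image_trunc_zero_le hs j S hS))

/-- Spiders are grown vertex by vertex. A spider with fewer edges blocks at most δ/2 neighbours of
the leaf to be extended, so each edge costs only a factor of two. -/
theorem le_card_spiders {δ : ℕ} (hδ : ∀ v, δ ≤ G.degree v) (hs : 0 < s) (m : ℕ) (j : Fin s → ℕ)
    (hj : ∑ i, j i = m) (hm : 2 * (m + s) ≤ δ) :
    Fintype.card V * δ ^ m ≤ 2 ^ m * #(spiders G j) := by
  induction m generalizing j with
  | zero =>
    have h0 : ∀ i, j i = 0 := fun i => (sum_eq_zero_iff.1 hj) i (mem_univ i)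
    simp only [pow_zero, mul_one, one_mul]
    refine card_le_card_of_injOn (s := univ) (fun v _ _ => v) ?_ ?_
    · intro v _
      exact mem_spiders.2 ⟨fun _ _ => rfl, fun i d hd => by simp [h0] at hd,
        fun i i' d d' hd hd' _ => by
          rw [h0] at hd hd'
          exact ⟨by omega, Or.inl (by omega)⟩, fun _ _ => rfl⟩
    · intro v _ w _ he
      exact congrFun (congrFun he ⟨0, hs⟩) 0
  | succ m ih =>
    obtain ⟨i, hi⟩ : ∃ i, 0 < j i := by
      by_contra! hc
      have : ∑ i, j i = 0 := sum_eq_zero fun i _ => by have := hc i; omega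
      omega
    set j1 := Function.update j i (j i - 1) with hj1
    have hj1i : j1 i + 1 = j i := by simp [hj1]; omega
    have hj1' : ∀ a, a ≠ i → j1 a = j a := fun a ha => by simp [hj1, ha]
    have hjj : j = Function.update j1 i (j1 i + 1) := by
      funext a
      by_cases ha : a = i
      · subst ha; simp [hj1i]
      · simp [hj1' a ha, ha]
    have hle2 : ∀ a, j1 a ≤ j a := by
      intro a
      by_cases ha : a = i
      · subst ha; omega
      · rw [hj1' a ha]
    have hsum : ∑ a, j1 a + 1 = ∑ a, j a := sum_add_one_of_update hj1i hj1'
    have hfib : ∀ p ∈ spiders G j1, δ - (m + s) ≤ #{q ∈ spiders G j | trunc j1 q = p} := by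
      intro p hp
      have hp := mem_spiders.1 hp
      have h1 : δ - (m + s) ≤ #(G.neighborFinset (p i (j1 i)) \ spiderVerts j1 p) := by
        have h2 := le_card_sdiff (spiderVerts j1 p) (G.neighborFinset (p i (j1 i)))
        have h3 := card_spiderVerts_le j1 p
        have h4 := hδ (p i (j1 i))
        rw [G.card_neighborFinset_eq_degree] at h2
        omega
      refine h1.trans (card_le_card_of_injOn
        (fun u => Function.update p i (fun d => if d ≤ j1 i then p i d else u)) ?_ ?_)
      · intro u hu
        obtain ⟨hu1, hu2⟩ := mem_sdiff.1 hu
        refine mem_filter.2 ⟨mem_spiders.2 ?_, ?_⟩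
        · rw [hjj]
          exact hp.extend i (by simpa using hu1) hu2
        · conv_rhs => rw [← hp.trunc_self]
          funext a d
          simp only [trunc]
          by_cases ha : a = i
          · subst ha; simp
          · simp [ha]
      · intro u _ v _ he
        simpa using congrFun (congrFun he i) (j1 i + 1)
    have hcard : #(spiders G j1) * (δ - (m + s)) ≤ #(spiders G j) := by
      rw [card_eq_sum_card_fiberwise (s := spiders G j) (f := trunc j1) (t := spiders G j1)
        (fun p hp => mem_spiders.2 ((mem_spiders.1 hp).trunc hle2))]
      have := card_nsmul_le_sum (spiders G j1) _ _ hfib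
      simpa using this
    have := ih j1 (by omega) (by omega)
    calc Fintype.card V * δ ^ (m + 1) = Fintype.card V * δ ^ m * δ := by ring
      _ ≤ 2 ^ m * #(spiders G j1) * (2 * (δ - (m + s))) := Nat.mul_le_mul this (by omega)
      _ = 2 ^ (m + 1) * (#(spiders G j1) * (δ - (m + s))) := by ring
      _ ≤ _ := Nat.mul_le_mul_left _ hcard

theorem card_le_card_image_shift_mul {Δ : ℕ} (hΔ : ∀ v, G.degree v ≤ Δ) (a : ℕ)
    (S : Finset (ℕ → V)) (hS : ∀ q ∈ S, ∀ d < a, G.Adj (q d) (q (d + 1))) :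
    #S ≤ #(S.image fun q d => q (a + d)) * Δ ^ a := by
  induction a generalizing S with
  | zero => simp
  | succ a ih =>
    have hstep : #S ≤ Δ * #(S.image fun (q : ℕ → V) d => q (d + 1)) := by
      refine card_le_mul_card_image S Δ fun b _ => ?_
      refine (card_le_card_of_injOn (t := G.neighborFinset (b 0)) (fun q => q 0) ?_ ?_).trans (hΔ _)
      · intro q hq
        obtain ⟨hq', rfl⟩ := mem_filter.1 hq
        simpa using (hS q hq' 0 (by omega)).symm
      · intro p hp q hq he
        obtain ⟨hp, hpb⟩ := mem_filter.1 hp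
        obtain ⟨hq, hqb⟩ := mem_filter.1 hq
        funext d
        cases d with
        | zero => exact he
        | succ d => exact congrFun (hpb.trans hqb.symm) d
    have := ih (S.image fun q d => q (d + 1)) (by
      intro q' hq' d hd
      obtain ⟨q, hq, rfl⟩ := mem_image.1 hq'
      exact hS q hq (d + 1) (by omega))
    rw [image_image] at this
    have he : ((fun (q : ℕ → V) d => q (a + d)) ∘ fun (q : ℕ → V) d => q (d + 1)) =
        fun (q : ℕ → V) d => q (a + 1 + d) := by
      funext q d
      simp only [Function.comp]
      congr 1
      omega
    rw [he] at this
    calc #S ≤ Δ * #(S.image fun (q : ℕ → V) d => q (d + 1)) := hstep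
      _ ≤ Δ * (#(S.image fun (q : ℕ → V) d => q (a + 1 + d)) * Δ ^ a) := Nat.mul_le_mul_left _ this
      _ = _ := by ring

/-- There are at most `Δ ^ r` walks of length `r` ending at a given vertex. -/
theorem card_walks_le {Δ : ℕ} (hΔ : ∀ v, G.degree v ≤ Δ) (r : ℕ) (w : V) (S : Finset (ℕ → V))
    (hS : ∀ q ∈ S, ∀ d < r, G.Adj (q d) (q (d + 1))) (hw : ∀ q ∈ S, ∀ d, r ≤ d → q d = w) :
    #S ≤ Δ ^ r := by
  refine (card_le_card_image_shift_mul hΔ r S hS).trans ?_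
  have : #(S.image fun (q : ℕ → V) d => q (r + d)) ≤ 1 := by
    refine card_le_one.2 fun a ha b hb => ?_
    obtain ⟨p, hp, rfl⟩ := mem_image.1 ha
    obtain ⟨q, hq, rfl⟩ := mem_image.1 hb
    funext d
    exact (hw p hp _ (Nat.le_add_right r d)).trans (hw q hq _ (Nat.le_add_right r d)).symm
  calc _ ≤ 1 * Δ ^ r := Nat.mul_le_mul_right _ this
    _ = _ := one_mul _

/-- The part of the `i`-th leg between the distances `a` and `a + l` from the center. -/
def seg (i : Fin s) (a l : ℕ) (p : Fin s → ℕ → V) : ℕ → V := fun d => p i (a + min d l)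

/-- The segment contains `l` of the edges of the spider. The leg is continued from it to the center,
then everything else is grown outwards, with at most `Δ` choices per remaining edge. -/
theorem card_le_card_image_seg_mul {Δ : ℕ} (hΔ : ∀ v, G.degree v ≤ Δ) (L : Fin s → ℕ) (i : Fin s)
    (a l : ℕ) (hal : a + l ≤ L i) (S : Finset (Fin s → ℕ → V)) (hS : ∀ p ∈ S, IsSpider G L p) :
    #S ≤ #(S.image (seg i a l)) * Δ ^ (∑ i, L i - l) := by
  set j : Fin s → ℕ := Pi.single i (a + l) with hj
  have hji : j i = a + l := by simp [hj]
  have hj0 : ∀ i', i' ≠ i → j i' = 0 := fun i' h => by simp [hj, h]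
  have hle : ∀ i', j i' ≤ L i' := by
    intro i'
    by_cases h : i' = i
    · subst h; omega
    · rw [hj0 i' h]; omega
  have hsum : ∑ i', j i' = a + l := by simp [hj]
  have hsumle : ∑ i', j i' ≤ ∑ i', L i' := sum_le_sum fun i' _ => hle i'
  have h1 := card_le_card_image_trunc_mul hΔ (∑ i, L i - (a + l)) j L hle (by omega) S hS
  have h2 : #(S.image (trunc j)) ≤ #(S.image (seg i 0 (a + l))) := by
    have : S.image (seg i 0 (a + l)) = (S.image (trunc j)).image (fun p => p i) := by
      rw [image_image]
      refine image_congr fun p _ => ?_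
      funext d
      simp [seg, trunc, hji]
    rw [this]
    refine (card_image_of_injOn ?_).ge
    intro p hp q hq he
    obtain ⟨p, hp', rfl⟩ := mem_image.1 hp
    obtain ⟨q, hq', rfl⟩ := mem_image.1 hq
    funext i' d
    by_cases h : i' = i
    · subst h; exact congrFun he d
    · have h0 := congrFun he 0
      simp only [trunc, Nat.zero_min, hj0 i' h, Nat.min_zero] at h0 ⊢
      rw [(hS p hp').center i' i, (hS q hq').center i' i, h0]
  have h3 := card_le_card_image_shift_mul hΔ a (S.image (seg i 0 (a + l))) (by
    intro q hq d hd
    obtain ⟨p, hp, rfl⟩ := mem_image.1 hq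
    simp only [seg, zero_add]
    rw [min_eq_left (by omega), min_eq_left (by omega)]
    exact (hS p hp).adj i d (by omega))
  have h4 : (S.image (seg i 0 (a + l))).image (fun q d => q (a + d)) = S.image (seg i a l) := by
    rw [image_image]
    refine image_congr fun p _ => ?_
    funext d
    simp only [seg, Function.comp]
    congr 1
    omega
  rw [h4] at h3
  calc #S ≤ #(S.image (seg i a l)) * Δ ^ a * Δ ^ (∑ i, L i - (a + l)) :=
        h1.trans (Nat.mul_le_mul_right _ (h2.trans h3))
    _ = #(S.image (seg i a l)) * Δ ^ (∑ i, L i - l) := by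
      rw [mul_assoc, ← pow_add]
      congr 2
      omega

/-- The path with two edges around the center that is formed by the first vertices of two legs. -/
def bend (i i' : Fin s) (p : Fin s → ℕ → V) : ℕ → V := fun d =>
  if d = 0 then p i 1 else if d = 1 then p i 0 else p i' 1

theorem card_le_card_image_bend_mul {Δ : ℕ} (hΔ : ∀ v, G.degree v ≤ Δ) (L : Fin s → ℕ)
    (i i' : Fin s) (hii : i ≠ i') (hL : ∀ i, 1 ≤ L i)
    (S : Finset (Fin s → ℕ → V)) (hS : ∀ p ∈ S, IsSpider G L p) :
    #S ≤ #(S.image (bend i i')) * Δ ^ (∑ i, L i - 2) := by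
  set j : Fin s → ℕ := fun a => if a = i ∨ a = i' then 1 else 0 with hj
  have hle : ∀ a, j a ≤ L a := by
    intro a
    simp only [hj]
    split_ifs
    · exact hL a
    · omega
  have hsum : ∑ a, j a = 2 := by
    rw [hj, sum_boole, show univ.filter (fun a => a = i ∨ a = i') = {i, i'} by ext; simp,
      card_pair hii]
    rfl
  have hsumle : ∑ a, j a ≤ ∑ a, L a := sum_le_sum fun a _ => hle a
  refine (card_le_card_image_trunc_mul hΔ (∑ i, L i - 2) j L hle (by omega) S hS).trans
    (Nat.mul_le_mul_right _ ?_)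
  have : S.image (bend i i') = (S.image (trunc j)).image (bend i i') := by
    rw [image_image]
    refine image_congr fun p _ => ?_
    funext d
    simp [bend, trunc, hj]
  rw [this]
  refine (card_image_of_injOn ?_).ge
  intro p hp q hq he
  obtain ⟨p, hp', rfl⟩ := mem_image.1 hp
  obtain ⟨q, hq', rfl⟩ := mem_image.1 hq
  have h0 := congrFun he 0
  have h1 := congrFun he 1
  have h2 := congrFun he 2
  simp [bend, trunc, hj] at h0 h1 h2
  funext a d
  have hc : p a 0 = q a 0 := by
    rw [(hS p hp').center a i, (hS q hq').center a i, h1]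
  simp only [trunc]
  by_cases hd : min d (j a) = 0
  · rw [hd, hc]
  · by_cases ha : a = i
    · subst ha
      have : min d (j a) = 1 := by
        have : j a = 1 := by simp [hj]
        omega
      rw [this, h0]
    · by_cases ha' : a = i'
      · subst ha'
        have : min d (j a) = 1 := by
          have : j a = 1 := by simp [hj]
          omega
        rw [this, h2]
      · have : j a = 0 := by simp [hj, ha, ha']
        omega

end Counting

end ManyTuran

/-! ### Pairs of vertices joined by many paths -/

namespace ManyTuran

open Finset
open scoped Classical

/-- Union bound: each pair of a coordinate and a forbidden value excludes at most `g` elements. -/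
theorem exists_forall_notMem {α ι V : Type*} (T : Finset α) (I : Finset ι) (val : α → ι → V)
    (W : Finset V) (g : ℕ) (h : ∀ i ∈ I, ∀ p ∈ T, #{q ∈ T | val q i = val p i} ≤ g)
    (hc : #I * #W * g < #T) : ∃ p ∈ T, ∀ i ∈ I, val p i ∉ W := by
  by_contra! hcon
  have hsub : T ⊆ (I ×ˢ W).biUnion fun e => {q ∈ T | val q e.1 = e.2} := by
    intro p hp
    obtain ⟨i, hi, hw⟩ := hcon p hp
    exact mem_biUnion.2 ⟨(i, val p i), mem_product.2 ⟨hi, hw⟩, mem_filter.2 ⟨hp, rfl⟩⟩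
  have h1 := (card_le_card hsub).trans (card_biUnion_le_card_mul _ _ g (by
    rintro ⟨i, w⟩ he
    rcases ({q ∈ T | val q i = w}).eq_empty_or_nonempty with h0 | ⟨p, hp⟩
    · simp [h0]
    · obtain ⟨hp', rfl⟩ := mem_filter.1 hp
      exact h i (mem_product.1 he).1 p hp'))
  rw [card_product] at h1
  omega

variable {V : Type*}

theorem IsPathOn.append {G : SimpleGraph V} {r l : ℕ} {q p : ℕ → V} (hq : IsPathOn G r q)
    (hp : IsPathOn G l p) (h : q r = p 0) (hne : ∀ a d, a ≤ r → 0 < d → d ≤ l → q a ≠ p d) :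
    IsPathOn G (r + l) (fun d => if d ≤ r then q d else p (d - r)) where
  adj a ha := by
    by_cases h1 : a + 1 ≤ r
    · rw [if_pos h1, if_pos (by omega)]
      exact hq.adj a (by omega)
    · rw [if_neg h1]
      split_ifs with h2
      · have : a = r := by omega
        subst this
        rw [h, Nat.add_sub_cancel_left]
        exact hp.adj 0 (by omega)
      · rw [show a + 1 - r = a - r + 1 by omega]
        exact hp.adj _ (by omega)
  inj a a' ha ha' he := by
    split_ifs at he with h1 h2 h2
    · exact hq.inj _ _ h1 h2 he
    · exact absurd he (hne _ _ h1 (by omega) (by omega))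
    · exact absurd he.symm (hne _ _ h2 (by omega) (by omega))
    · have := hp.inj _ _ (by omega) (by omega) he
      omega

theorem IsPathOn.reverse {G : SimpleGraph V} {r : ℕ} {q : ℕ → V} (hq : IsPathOn G r q) :
    IsPathOn G r (fun d => q (r - d)) where
  adj a ha := by
    have := hq.adj (r - (a + 1)) (by omega)
    rw [show r - (a + 1) + 1 = r - a by omega] at this
    exact this.symm
  inj a a' ha ha' he := by
    have := hq.inj _ _ (by omega) (by omega) he
    omega

theorem isSpider_of_legs {s : ℕ} {G : SimpleGraph V} {L : Fin s → ℕ} {P : Fin s → ℕ → V} {c : V}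
    (h0 : ∀ i, P i 0 = c) (hP : ∀ i, IsPathOn G (L i) (P i))
    (hne : ∀ i i' d d', i ≠ i' → 0 < d → d ≤ L i → 0 < d' → d' ≤ L i' → P i d ≠ P i' d') :
    IsSpider G L (fun i d => P i (min d (L i))) where
  center i i' := by simp [h0]
  adj i d hd := by
    rw [min_eq_left hd.le, min_eq_left hd]
    exact (hP i).adj d hd
  inj i i' d d' hd hd' he := by
    rw [min_eq_left hd, min_eq_left hd'] at he
    by_cases hi : i = i'
    · subst hi
      exact ⟨(hP i).inj _ _ hd hd' he, Or.inr rfl⟩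
    · rcases Nat.eq_zero_or_pos d with rfl | hd0 <;> rcases Nat.eq_zero_or_pos d' with rfl | hd0'
      · simp
      · rw [h0, ← h0 i'] at he
        exact absurd ((hP i').inj _ _ (by omega) hd' he) (by omega)
      · rw [h0, ← h0 i] at he
        exact absurd ((hP i).inj _ _ hd (by omega) he) (by omega)
      · exact absurd he (hne i i' d d' hi hd0 hd hd0' hd')
  stab i d := by simp

/-- If positively many paths of length `l` join pairs of vertices with many such paths, then there
are vertices `x i` and a bipartite graph of large minimum degree all of whose vertices on one side
are joined to all `x i` by such paths. -/
theorem exists_dense_pair {s k : ℕ} (hs : 0 < s) (K A D g : ℕ) (hK : 1 ≤ K) (hA : 1 ≤ A) :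
    ∃ f₀ d₀ : ℕ, ∀ {V : Type*} [Fintype V] (G : SimpleGraph V) [DecidableRel G.Adj] (δ Δ l : ℕ)
      (S : Finset (ℕ → V)), 0 < Fintype.card V → (∀ v, G.degree v ≤ Δ) → Δ ≤ K * δ → d₀ ≤ δ →
      2 ≤ l → l ≤ k → (∀ p ∈ S, IsPathOn G l p) → (∀ p ∈ S, ∀ d, p d = p (min d l)) →
      Fintype.card V * δ ^ l ≤ A * #S →
      (∀ p ∈ S, f₀ < #{q ∈ S | q 0 = p 0 ∧ q l = p l}) →
      (∀ d y x v, 0 < d → d < l → #{q ∈ S | q 0 = y ∧ q l = x ∧ q d = v} ≤ g) →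
      ∃ (x : Fin s → V) (E : Finset (V × V)), Function.Injective x ∧ E.Nonempty ∧
        (∀ e ∈ E, G.Adj e.1 e.2) ∧ (∀ e ∈ E, D ≤ #{e' ∈ E | e'.1 = e.1}) ∧
        (∀ e ∈ E, D ≤ #{e' ∈ E | e'.2 = e.2}) ∧
        ∀ e ∈ E, ∀ i, ∃ p ∈ S, p 0 = e.1 ∧ p l = x i := by
  -- `B` is such that stems with fewer than δ/B continuations carry at most half of the δ^l / A
  -- paths guaranteed below. `1 / A₂` bounds from below the proportion, relative to δ^(l-1), of
  -- stems that continue to all `x i`.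
  set B := 2 * A * K ^ k with hB
  set A₂ := 2 * A * K * (2 * K * B) ^ s with hA₂
  refine ⟨g * D * (1 + K ^ k * A₂ * g) + 1, 2 * B * (s + 1), ?_⟩
  intro V _ G _ δ Δ l S hn hΔ hKΔ hδ hl2 hlk hS hstab hcard hf hgS
  have hKk : 1 ≤ K ^ k := Nat.one_le_pow _ _ hK
  have hBpos : 1 ≤ B := by
    have : 1 ≤ A * K ^ k := Nat.mul_pos hA hKk
    rw [hB, mul_assoc]; omega
  have hδpos : 0 < δ := by
    have : 0 < 2 * B * (s + 1) := by positivity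
    omega
  have hΔpow : Δ ^ (l - 1) ≤ K ^ k * δ ^ (l - 1) := by
    calc Δ ^ (l - 1) ≤ (K * δ) ^ (l - 1) := Nat.pow_le_pow_left hKΔ _
      _ = K ^ (l - 1) * δ ^ (l - 1) := mul_pow _ _ _
      _ ≤ _ := Nat.mul_le_mul_right _ (Nat.pow_le_pow_right hK (by omega))
  -- the last but one vertex
  obtain ⟨w, hw⟩ : ∃ w, δ ^ l ≤ A * #{p ∈ S | p (l - 1) = w} := by
    have : Nonempty V := Fintype.card_pos_iff.1 hn
    obtain ⟨w, -, hw⟩ := exists_max_image univ (fun w : V => #{p ∈ S | p (l - 1) = w})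
      univ_nonempty
    have h1 : #S ≤ Fintype.card V * #{p ∈ S | p (l - 1) = w} := by
      rw [card_eq_sum_card_fiberwise (s := S) (f := fun p => p (l - 1)) (t := univ)
        (fun _ _ => mem_univ _)]
      refine (sum_le_card_nsmul _ _ _ hw).trans (by simp)
    refine ⟨w, Nat.le_of_mul_le_mul_left (hcard.trans ?_) hn⟩
    calc A * #S ≤ A * (Fintype.card V * #{p ∈ S | p (l - 1) = w}) := Nat.mul_le_mul_left _ h1
      _ = _ := by ring
  set T := S.filter (fun p => p (l - 1) = w) with hT
  have hTS : ∀ p ∈ T, p ∈ S := fun p hp => (mem_filter.1 hp).1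
  have hTw : ∀ p ∈ T, p (l - 1) = w := fun p hp => (mem_filter.1 hp).2
  -- The stem of a path: its last vertex is dropped. Stems of paths in `T` end at `w`, and a path is
  -- determined by its stem and a neighbour of `w`.
  let τ : (ℕ → V) → ℕ → V := fun p d => p (min d (l - 1))
  have hτinj : ∀ p ∈ S, ∀ q ∈ S, τ p = τ q → p l = q l → p = q := by
    intro p hp q hq h1 h2
    funext d
    by_cases hd : d ≤ l - 1
    · have := congrFun h1 d
      simpa only [τ, min_eq_left hd] using this
    · rw [hstab p hp, hstab q hq, min_eq_right (by omega), h2]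
  set Q := T.image τ with hQ
  have hQcard : #Q ≤ K ^ k * δ ^ (l - 1) := by
    refine (card_walks_le hΔ (l - 1) w Q ?_ ?_).trans hΔpow
    · intro q hq d hd
      obtain ⟨p, hp, rfl⟩ := mem_image.1 hq
      simp only [τ]
      rw [min_eq_left (by omega), min_eq_left (by omega)]
      exact (hS p (hTS p hp)).adj d (by omega)
    · intro q hq d hd
      obtain ⟨p, hp, rfl⟩ := mem_image.1 hq
      simp only [τ, min_eq_right hd]
      exact hTw p hp
  obtain ⟨R, hR⟩ : ∃ R : (ℕ → V) → V → Prop, ∀ q y, R q y ↔ ∃ p ∈ T, τ p = q ∧ p l = y :=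
    ⟨fun q y => ∃ p ∈ T, τ p = q ∧ p l = y, fun _ _ => Iff.rfl⟩
  set X := G.neighborFinset w with hX
  have hXcard : #X ≤ Δ := hΔ w
  have hfib : ∀ q, #{p ∈ T | τ p = q} ≤ #{y ∈ X | R q y} := by
    intro q
    refine card_le_card_of_injOn (fun p => p l) ?_ ?_
    · intro p hp
      obtain ⟨hp, hpq⟩ := mem_filter.1 hp
      refine mem_filter.2 ⟨?_, (hR _ _).2 ⟨p, hp, hpq, rfl⟩⟩
      have := (hS p (hTS p hp)).adj (l - 1) (by omega)
      rw [hTw p hp, Nat.sub_add_cancel (by omega)] at this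
      simpa [hX] using this
    · intro p hp p' hp' he
      obtain ⟨hp, hpq⟩ := mem_filter.1 hp
      obtain ⟨hp', hpq'⟩ := mem_filter.1 hp'
      exact hτinj p (hTS _ hp) p' (hTS _ hp') (hpq.trans hpq'.symm) he
  set Q₀ := Q.filter (fun q => δ / B ≤ #{y ∈ X | R q y}) with hQ₀
  have hTcard : #T ≤ δ / B * #Q + Δ * #Q₀ := by
    rw [card_eq_sum_card_fiberwise (s := T) (f := τ) (t := Q)
      (fun p hp => mem_image_of_mem _ hp), ← sum_filter_add_sum_filter_not Q
      (fun q => δ / B ≤ #{y ∈ X | R q y}), add_comm]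
    refine Nat.add_le_add ?_ ?_
    · refine (sum_le_card_nsmul _ _ (δ / B) ?_).trans ?_
      · intro q hq
        have := (mem_filter.1 hq).2
        exact (hfib q).trans (by omega)
      · rw [smul_eq_mul, mul_comm]
        exact Nat.mul_le_mul_left _ (card_le_card (filter_subset _ _))
    · refine (sum_le_card_nsmul _ _ Δ ?_).trans (by rw [smul_eq_mul, mul_comm])
      exact fun q _ => (hfib q).trans ((card_le_card (filter_subset _ _)).trans hXcard)
  have hpow : δ ^ l = δ * δ ^ (l - 1) := by
    rw [← pow_succ', Nat.sub_add_cancel (by omega)]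
  have hQ₀card : δ ^ (l - 1) ≤ 2 * A * K * #Q₀ := by
    have h1 : 2 * A * (δ / B * #Q) ≤ δ * δ ^ (l - 1) := by
      calc 2 * A * (δ / B * #Q) ≤ 2 * A * (δ / B * (K ^ k * δ ^ (l - 1))) := by gcongr
        _ = B * (δ / B) * δ ^ (l - 1) := by rw [hB]; ring
        _ ≤ _ := Nat.mul_le_mul_right _ (Nat.mul_div_le _ _)
    have h2 : 2 * A * (Δ * #Q₀) ≤ δ * (2 * A * K * #Q₀) := by
      calc 2 * A * (Δ * #Q₀) ≤ 2 * A * (K * δ * #Q₀) := by gcongr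
        _ = _ := by ring
    have h3 : 2 * (δ * δ ^ (l - 1)) ≤ 2 * A * (δ / B * #Q) + 2 * A * (Δ * #Q₀) := by
      rw [← hpow]
      calc 2 * δ ^ l ≤ 2 * (A * #T) := by omega
        _ ≤ 2 * (A * (δ / B * #Q + Δ * #Q₀)) := by gcongr
        _ = _ := by ring
    exact Nat.le_of_mul_le_mul_left (by omega) hδpos
  obtain ⟨θ, hθ⟩ : ∃ θ, δ / B = θ + s := by
    have : 2 * (s + 1) ≤ δ / B := by
      rw [Nat.le_div_iff_mul_le hBpos]
      calc 2 * (s + 1) * B = 2 * B * (s + 1) := by ring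
        _ ≤ δ := hδ
    exact ⟨δ / B - s, by omega⟩
  have hθs : s + 2 ≤ θ := by
    have : 2 * (s + 1) ≤ δ / B := by
      rw [Nat.le_div_iff_mul_le hBpos]
      calc 2 * (s + 1) * B = 2 * B * (s + 1) := by ring
        _ ≤ δ := hδ
    omega
  have hδθ : δ ≤ 2 * B * θ := by
    have h1 : δ < B * (δ / B + 1) := Nat.lt_mul_div_succ _ hBpos
    calc δ ≤ B * (δ / B + 1) := h1.le
      _ ≤ B * (2 * θ) := Nat.mul_le_mul_left _ (by omega)
      _ = _ := by ring
  have hQ₀ne : Q₀.Nonempty := by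
    rw [← card_pos]
    refine Nat.pos_of_mul_pos_left (a := 2 * A * K) ?_
    exact (pow_pos hδpos _).trans_le hQ₀card
  -- Between rich stems and neighbours of `w` the relation `R` has positive density, so `s`
  -- neighbours continue a positive proportion of the stems simultaneously.
  obtain ⟨x, hx, hxle⟩ := exists_common_neighbors R X θ s Q₀
    (fun q hq => by rw [← hθ]; exact (mem_filter.1 hq).2) hQ₀ne (by omega)
  set Qm := Q₀.filter (fun q => ∀ i, R q (x i)) with hQm
  have hQmcard : δ ^ (l - 1) ≤ A₂ * #Qm := by
    have h1 : #Q₀ ≤ (2 * K * B) ^ s * #Qm := by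
      refine Nat.le_of_mul_le_mul_right (c := θ ^ s) (hxle.trans ?_) (pow_pos (by omega) _)
      calc #Qm * #X ^ s ≤ #Qm * (2 * K * B * θ) ^ s := by
            gcongr
            calc #X ≤ K * δ := hXcard.trans hKΔ
              _ ≤ K * (2 * B * θ) := Nat.mul_le_mul_left _ hδθ
              _ = _ := by ring
        _ = (2 * K * B) ^ s * #Qm * θ ^ s := by rw [mul_pow]; ring
    calc δ ^ (l - 1) ≤ 2 * A * K * #Q₀ := hQ₀card
      _ ≤ 2 * A * K * ((2 * K * B) ^ s * #Qm) := Nat.mul_le_mul_left _ h1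
      _ = _ := by rw [hA₂]; ring
  let i₀ : Fin s := ⟨0, hs⟩
  set Y := Qm.image (fun q => q 0) with hY
  -- Stems in `Qm` with a common start `y` extend to paths from `y` to `x i₀` through `w`, of which
  -- there are at most `g`.
  have hYcard : #Qm ≤ g * #Y := by
    refine card_le_mul_card_image Qm g fun y _ => ?_
    refine le_trans ?_ (hgS (l - 1) y (x i₀) w (by omega) (by omega))
    refine le_trans (card_le_card ?_) (card_image_le (f := τ))
    intro q hq
    obtain ⟨hq, hqy⟩ := mem_filter.1 hq
    obtain ⟨p, hp, hpq, hpx⟩ := (hR _ _).1 ((mem_filter.1 hq).2 i₀)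
    refine mem_image.2 ⟨p, mem_filter.2 ⟨hTS p hp, ?_, hpx, hTw p hp⟩, hpq⟩
    rw [← hqy, ← hpq]
    simp [τ]
  have hYp : ∀ y ∈ Y, ∀ i, ∃ p ∈ S, p 0 = y ∧ p l = x i := by
    intro y hy i
    obtain ⟨q, hq, rfl⟩ := mem_image.1 hy
    obtain ⟨p, hp, hpq, hpx⟩ := (hR _ _).1 ((mem_filter.1 hq).2 i)
    refine ⟨p, hTS p hp, ?_, hpx⟩
    rw [← hpq]
    simp [τ]
  have hYpos : 0 < #Y := by
    refine Nat.pos_of_mul_pos_left (a := g) (lt_of_lt_of_le ?_ hYcard)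
    refine Nat.pos_of_mul_pos_left (a := A₂) (lt_of_lt_of_le ?_ hQmcard)
    exact pow_pos hδpos _
  -- Many paths to `x i₀` start at each vertex of `Y`, while their second vertices start walks of
  -- length l-1 to `x i₀`, so there are at most Δ^(l-1) = O(#Y) of them. Hence the first edges `E`
  -- are dense on both sides, and cleaning yields minimum degree `D`.
  set Z := S.filter (fun p => p l = x i₀ ∧ p 0 ∈ Y) with hZ
  set E := Z.image (fun p => (p 0, p 1)) with hE
  have hZE : #Z ≤ g * #E := by
    refine card_le_mul_card_image Z g fun e _ => ?_
    refine le_trans (card_le_card ?_) (hgS 1 e.1 (x i₀) e.2 (by omega) (by omega))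
    intro p hp
    obtain ⟨hpZ, rfl⟩ := mem_filter.1 hp
    obtain ⟨hpS, hp1, -⟩ := mem_filter.1 hpZ
    exact mem_filter.2 ⟨hpS, rfl, hp1, rfl⟩
  have hZcard : (g * D * (1 + K ^ k * A₂ * g) + 1) * #Y ≤ #Z := by
    rw [card_eq_sum_card_fiberwise (s := Z) (f := fun p => p 0) (t := Y)
      (fun p hp => (mem_filter.1 hp).2.2), mul_comm, ← smul_eq_mul]
    refine card_nsmul_le_sum _ _ _ fun y hy => ?_
    obtain ⟨p, hp, hp0, hpl⟩ := hYp y hy i₀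
    refine (hf p hp).le.trans (card_le_card ?_)
    intro q hq
    obtain ⟨hq, hq0, hql⟩ := mem_filter.1 hq
    rw [hp0] at hq0
    exact mem_filter.2 ⟨mem_filter.2 ⟨hq, hql.trans hpl, hq0 ▸ hy⟩, hq0⟩
  have hE1 : #(E.image Prod.fst) ≤ #Y := by
    refine card_le_card fun y hy => ?_
    obtain ⟨e, he, rfl⟩ := mem_image.1 hy
    obtain ⟨p, hp, rfl⟩ := mem_image.1 he
    exact (mem_filter.1 hp).2.2
  have hE2 : #(E.image Prod.snd) ≤ K ^ k * A₂ * g * #Y := by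
    have h1 : E.image Prod.snd = (Z.image fun (p : ℕ → V) d => p (d + 1)).image (fun q => q 0) := by
      rw [hE, image_image, image_image]
      rfl
    calc #(E.image Prod.snd) ≤ #(Z.image fun (p : ℕ → V) d => p (d + 1)) := by
          rw [h1]; exact card_image_le
      _ ≤ Δ ^ (l - 1) := by
          refine card_walks_le hΔ (l - 1) (x i₀) _ ?_ ?_
          · intro q hq d hd
            obtain ⟨p, hp, rfl⟩ := mem_image.1 hq
            exact (hS p (mem_filter.1 hp).1).adj (d + 1) (by omega)
          · intro q hq d hd
            obtain ⟨p, hp, rfl⟩ := mem_image.1 hq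
            obtain ⟨hp, hpx, -⟩ := mem_filter.1 hp
            change p (d + 1) = _
            rw [hstab p hp, min_eq_right (by omega), hpx]
      _ ≤ K ^ k * (A₂ * (g * #Y)) := hΔpow.trans
          (Nat.mul_le_mul_left _ (hQmcard.trans (Nat.mul_le_mul_left _ hYcard)))
      _ = _ := by ring
  obtain ⟨E', hE'E, hE'ne, hE'⟩ := exists_subset_fibers_large (ι := Bool)
    (fun c => if c then Prod.fst else Prod.snd) (fun _ => D) E (by
      simp only [Fintype.sum_bool, if_true, Bool.false_eq_true, if_false]
      refine Nat.lt_of_mul_lt_mul_left (a := g) (lt_of_lt_of_le ?_ (hZcard.trans hZE))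
      calc g * (D * #(E.image Prod.fst) + D * #(E.image Prod.snd))
          ≤ g * (D * #Y + D * (K ^ k * A₂ * g * #Y)) := by gcongr
        _ = g * D * (1 + K ^ k * A₂ * g) * #Y := by ring
        _ < (g * D * (1 + K ^ k * A₂ * g) + 1) * #Y := by
          rw [add_mul, one_mul]; omega)
  refine ⟨x, E', hx, hE'ne, ?_, ?_, ?_, ?_⟩
  · intro e he
    obtain ⟨p, hp, rfl⟩ := mem_image.1 (hE'E he)
    exact (hS p (mem_filter.1 hp).1).adj 0 (by omega)
  · intro e he
    simpa using hE' true e he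
  · intro e he
    simpa using hE' false e he
  · intro e he
    obtain ⟨p, hp, rfl⟩ := mem_image.1 (hE'E he)
    exact hYp _ (mem_filter.1 hp).2.2

/-- If, for some `2 ≤ l ≤ k`, positively many paths of length `l` join pairs of vertices with many
such paths, then `G` contains robustly connected leaves of spiders with legs `b, k, …, k`. -/
theorem exists_isRobust_of_many_paths {s k b : ℕ} (hs : 0 < s) (hb : 1 ≤ b) (K A N g : ℕ)
    (hK : 1 ≤ K) (hA : 1 ≤ A) :
    ∃ f₀ d₀ : ℕ, ∀ {V : Type*} [Fintype V] (G : SimpleGraph V) [DecidableRel G.Adj] (δ Δ l : ℕ)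
      (S : Finset (ℕ → V)), 0 < Fintype.card V → (∀ v, G.degree v ≤ Δ) → Δ ≤ K * δ → d₀ ≤ δ →
      2 ≤ l → l ≤ k → (∀ p ∈ S, IsPathOn G l p) → (∀ p ∈ S, ∀ d, p d = p (min d l)) →
      Fintype.card V * δ ^ l ≤ A * #S →
      (∀ p ∈ S, f₀ < #{q ∈ S | q 0 = p 0 ∧ q l = p l}) →
      (∀ d y x v, 0 < d → d < l → #{q ∈ S | q 0 = y ∧ q l = x ∧ q d = v} ≤ g) →
      ∃ x, IsRobust G (lengthVector s b k) N x := by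
  set N₁ := N + s + (b + 1) + k * s with hN₁
  obtain ⟨f₀, d₀, H⟩ := exists_dense_pair (k := k) hs K A (N₁ + s + k + 1) g hK hA
  refine ⟨f₀ + k * (N₁ + k + 1) * g, d₀, ?_⟩
  intro V _ G _ δ Δ l S hn hΔ hKΔ hδ hl2 hlk hS hstab hcard hf hgS
  obtain ⟨x, E, hx, hEne, hEadj, hE1, hE2, hES⟩ := H G δ Δ l S hn hΔ hKΔ hδ hl2 hlk hS hstab hcard
    (fun p hp => (Nat.le_add_right _ _).trans_lt (hf p hp)) hgS
  -- Parity of the countdown records the side: a walk in `E` that reaches `0` ends where paths to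
  -- all `x i` start.
  let M : ℕ → V → Prop := fun d v => if Even d then ∃ e ∈ E, e.1 = v else ∃ e ∈ E, e.2 = v
  have step : ∀ d v, M (d + 1) v → ∀ W : Finset V, #W ≤ N₁ + s + k →
      ∃ u, M d u ∧ G.Adj v u ∧ u ∉ W := by
    intro d v hv W hW
    by_cases hd : Even d
    · have hd' : ¬ Even (d + 1) := by rwa [Nat.even_add_one, not_not]
      simp only [M, hd, hd', if_true, if_false] at hv ⊢
      obtain ⟨e, he, rfl⟩ := hv
      by_contra! hc
      have h1 : #{e' ∈ E | e'.2 = e.2} ≤ #W := by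
        refine card_le_card_of_injOn Prod.fst ?_ ?_
        · intro e' he'
          obtain ⟨he', h2⟩ := mem_filter.1 he'
          exact hc e'.1 ⟨e', he', rfl⟩ (h2 ▸ (hEadj e' he').symm)
        · intro a ha a' ha' h
          exact Prod.ext h ((mem_filter.1 ha).2.trans (mem_filter.1 ha').2.symm)
      have := hE2 e he
      omega
    · have hd' : Even (d + 1) := by rwa [Nat.even_add_one]
      simp only [M, hd, hd', if_true, if_false] at hv ⊢
      obtain ⟨e, he, rfl⟩ := hv
      by_contra! hc
      have h1 : #{e' ∈ E | e'.1 = e.1} ≤ #W := by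
        refine card_le_card_of_injOn Prod.snd ?_ ?_
        · intro e' he'
          obtain ⟨he', h2⟩ := mem_filter.1 he'
          exact hc e'.2 ⟨e', he', rfl⟩ (h2 ▸ hEadj e' he')
        · intro a ha a' ha' h
          exact Prod.ext ((mem_filter.1 ha).2.trans (mem_filter.1 ha').2.symm) h
      have := hE1 e he
      omega
  obtain ⟨r, hr⟩ : ∃ r, k = r + l := ⟨k - l, by omega⟩
  have himx : #(univ.image x) ≤ s := card_image_le.trans (by simp)
  obtain ⟨z, hz, hzx⟩ : ∃ z, M (r + b) z ∧ z ∉ univ.image x := by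
    obtain ⟨e, he⟩ := hEne
    have : ∃ v, M (r + b + 1) v := by
      by_cases hd : Even (r + b + 1)
      · exact ⟨e.1, by simp only [M, hd, if_true]; exact ⟨e, he, rfl⟩⟩
      · exact ⟨e.2, by simp only [M, hd, if_false]; exact ⟨e, he, rfl⟩⟩
    obtain ⟨v, hv⟩ := this
    obtain ⟨u, hu, -, hux⟩ := step _ v hv (univ.image x) (by omega)
    exact ⟨u, hu, hux⟩
  have hks : k ≤ k * s := Nat.le_mul_of_pos_right _ hs
  let i₀ : Fin s := ⟨0, hs⟩
  have hL0 : lengthVector s b k i₀ = b := by simp [lengthVector, i₀]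
  have hL : ∀ i, i ≠ i₀ → lengthVector s b k i = k := by
    intro i hi
    have : i.val ≠ 0 := fun h => hi (Fin.ext h)
    simp [lengthVector, this]
  -- The leg of length `b` stays in `E`, from its leaf `z` to the center `c`. Every other leg makes
  -- `r = k - l` steps in `E` and then follows a path of length `l` to `x i`.
  refine ⟨Function.update x i₀ z, fun X hX => ?_⟩
  obtain ⟨q, c, hc, hq0, hqb, hq, hqW⟩ := exists_path_of_states G id M (N₁ + s + k) step b r z hz
    (X ∪ univ.image x) ((Nat.add_le_add_right (card_union_le _ _) _).trans (by omega))
  dsimp only [id] at hq0 hqb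
  have hqx : ∀ a ≤ b, q a ∉ univ.image x := by
    intro a ha
    rcases Nat.eq_zero_or_pos a with rfl | h
    · rwa [hq0]
    · exact fun hm => hqW a h ha (mem_union_right _ hm)
  have hcx : c ∉ univ.image x := hqb ▸ hqx b le_rfl
  have hcX : c ∉ X := fun hm => hqW b (by omega) le_rfl (mem_union_left _ (hqb ▸ hm))
  have hleg : ∀ i : Fin s, ∀ W : Finset V, #W ≤ N₁ → ∃ P : ℕ → V,
      (P 0 = c ∧ P k = x i ∧ IsPathOn G k P) ∧ Disjoint ((Ioo 0 k).image P) W := by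
    intro i W hW
    obtain ⟨q', y, hy, hq'0, hq'r, hq', hq'W⟩ := exists_path_of_states G id M (N₁ + s + k) step r 0 c
      (by rwa [zero_add]) (W ∪ univ.image x)
      ((Nat.add_le_add_right (card_union_le _ _) _).trans (by omega))
    dsimp only [id] at hq'0 hq'r
    simp only [M, Even.zero, if_true] at hy
    obtain ⟨e, he, rfl⟩ := hy
    obtain ⟨p, hp, hp0, hpx⟩ := hES e he i
    have hcW : #(W ∪ (range (r + 1)).image q') ≤ N₁ + k + 1 := by
      have : #((range (r + 1)).image q') ≤ r + 1 := card_image_le.trans (by simp)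
      exact (card_union_le _ _).trans (by omega)
    obtain ⟨p', hp', hp'W⟩ := exists_forall_notMem {a ∈ S | a 0 = p 0 ∧ a l = p l} (Ioo 0 l)
      (fun a d => a d) (W ∪ (range (r + 1)).image q') g (by
        intro d hd a ha
        rw [mem_Ioo] at hd
        rw [filter_filter]
        refine (card_le_card ?_).trans (hgS d (p 0) (p l) (a d) hd.1 hd.2)
        intro a' ha'
        simp only [mem_filter] at ha' ⊢
        tauto) (by
        refine lt_of_le_of_lt ?_ (hf p hp)
        refine (Nat.mul_le_mul_right _ (Nat.mul_le_mul ?_ hcW)).trans (Nat.le_add_left _ _)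
        simp
        omega)
    obtain ⟨hp'S, hp'0, hp'l⟩ := mem_filter.1 hp'
    have hq'x : ∀ a ≤ r, q' a ≠ x i := by
      intro a ha hax
      have hm : q' a ∈ univ.image x := hax ▸ mem_image_of_mem _ (mem_univ _)
      rcases Nat.eq_zero_or_pos a with rfl | h
      · exact hcx (hq'0 ▸ hm)
      · exact hq'W a h ha (mem_union_right _ hm)
    have happ := hq'.append (hS p' hp'S) (by rw [hq'r, hp'0, hp0]) (by
      intro a d ha hd hdl hne
      rcases hdl.lt_or_eq with h | rfl
      · refine hp'W d (mem_Ioo.2 ⟨hd, h⟩) (mem_union_right _ ?_)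
        exact mem_image.2 ⟨a, mem_range.2 (by omega), hne⟩
      · exact hq'x a ha (by rw [hne, hp'l, hpx]))
    rw [← hr] at happ
    refine ⟨_, ⟨?_, ?_, happ⟩, ?_⟩
    · simpa using hq'0
    · rw [if_neg (by omega), show k - r = l by omega, hp'l, hpx]
    · rw [disjoint_left]
      intro v hv
      obtain ⟨d, hd, rfl⟩ := mem_image.1 hv
      rw [mem_Ioo] at hd
      split_ifs with h
      · exact fun hm => hq'W d hd.1 h (mem_union_left _ hm)
      · exact fun hm => hp'W (d - r) (mem_Ioo.2 ⟨by omega, by omega⟩) (mem_union_left _ hm)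
  obtain ⟨P, hP, hPP⟩ := exists_disjoint_family
    (fun (i : Fin s) (P : ℕ → V) => P 0 = c ∧ P k = x i ∧ IsPathOn G k P)
    (fun _ P => (Ioo 0 k).image P) k N₁ (fun _ P => card_image_le.trans (by simp)) univ
    (fun i _ => hleg i) ⟨q⟩ (X ∪ univ.image x ∪ (range (b + 1)).image q) (by
      have h1 : #((range (b + 1)).image q) ≤ b + 1 := card_image_le.trans (by simp)
      have h2 := card_union_le (X ∪ univ.image x) ((range (b + 1)).image q)
      have h3 := card_union_le X (univ.image x)
      rw [card_univ, Fintype.card_fin]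
      omega)
  have hPX : ∀ i d, 0 < d → d < k → P i d ∉ X ∪ univ.image x ∪ (range (b + 1)).image q :=
    fun i d h0 hk => disjoint_left.1 (hP i (mem_univ _)).2
      (mem_image_of_mem _ (mem_Ioo.2 ⟨h0, hk⟩))
  have hPne : ∀ i i' d d', i ≠ i' → 0 < d → d ≤ k → 0 < d' → d' ≤ k → P i d ≠ P i' d' := by
    intro i i' d d' hi h0 hd h0' hd' he
    rcases hd.lt_or_eq with h | rfl <;> rcases hd'.lt_or_eq with h' | h'
    · refine disjoint_left.1 (hPP i (mem_univ _) i' (mem_univ _) hi)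
        (mem_image_of_mem _ (mem_Ioo.2 ⟨h0, h⟩)) ?_
      rw [he]
      exact mem_image_of_mem _ (mem_Ioo.2 ⟨h0', h'⟩)
    · refine hPX i d h0 h (mem_union_left _ (mem_union_right _ ?_))
      rw [he, h', (hP i' (mem_univ _)).1.2.1]
      exact mem_image_of_mem _ (mem_univ _)
    · refine hPX i' d' h0' h' (mem_union_left _ (mem_union_right _ ?_))
      rw [← he, (hP i (mem_univ _)).1.2.1]
      exact mem_image_of_mem _ (mem_univ _)
    · rw [h', (hP i (mem_univ _)).1.2.1, (hP i' (mem_univ _)).1.2.1] at he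
      exact hi (hx he)
  have hPq : ∀ i d a, 0 < d → d ≤ k → a ≤ b → P i d ≠ q a := by
    intro i d a h0 hd ha he
    rcases hd.lt_or_eq with h | rfl
    · refine hPX i d h0 h (mem_union_right _ ?_)
      rw [he]
      exact mem_image_of_mem _ (mem_range.2 (by omega))
    · refine hqx a ha ?_
      rw [← he, (hP i (mem_univ _)).1.2.1]
      exact mem_image_of_mem _ (mem_univ _)
  -- The long leg built for `i₀` is discarded in favour of the reversed walk from `z`.
  let P' : Fin s → ℕ → V := Function.update P i₀ (fun d => q (b - d))
  have hP'0 : P' i₀ = fun d => q (b - d) := Function.update_self ..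
  have hP' : ∀ i, i ≠ i₀ → P' i = P i := fun i hi => Function.update_of_ne hi ..
  have hcent : ∀ i, P' i 0 = c := by
    intro i
    by_cases hi : i = i₀
    · subst hi; rw [hP'0]; simpa using hqb
    · rw [hP' i hi]; exact (hP i (mem_univ _)).1.1
  refine ⟨_, isSpider_of_legs (L := lengthVector s b k) (P := P') hcent ?_ ?_, ?_, ?_⟩
  · intro i
    by_cases hi : i = i₀
    · subst hi; rw [hP'0, hL0]; exact hq.reverse
    · rw [hP' i hi, hL i hi]; exact (hP i (mem_univ _)).1.2.2
  · intro i i' d d' hii h0 hd h0' hd'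
    by_cases hi : i = i₀
    · subst hi
      have hi' : i' ≠ i₀ := hii.symm
      rw [hL i' hi'] at hd'
      rw [hP'0, hP' i' hi']
      exact (hPq i' d' _ h0' hd' (by omega)).symm
    · rw [hL i hi] at hd
      rw [hP' i hi]
      by_cases hi' : i' = i₀
      · subst hi'
        rw [hP'0]
        exact hPq i d _ h0 hd (by omega)
      · rw [hL i' hi'] at hd'
        rw [hP' i' hi']
        exact hPne i i' d d' hii h0 hd h0' hd'
  · intro i
    simp only [min_self]
    by_cases hi : i = i₀
    · subst hi; rw [hP'0, hL0]; simpa using hq0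
    · rw [hP' i hi, hL i hi, Function.update_of_ne hi]; exact (hP i (mem_univ _)).1.2.1
  · intro i d hd
    rw [min_eq_left hd.le]
    by_cases hi : i = i₀
    · subst hi
      rw [hP'0]
      exact fun hm => hqW (b - d) (by omega) (by omega) (mem_union_left _ hm)
    · rcases Nat.eq_zero_or_pos d with rfl | h0
      · rw [hcent]; exact hcX
      · rw [hP' i hi]
        rw [hL i hi] at hd
        exact fun hm => hPX i d h0 hd (mem_union_left _ (mem_union_left _ hm))

end ManyTuran

/-! ### Flexible sets of spiders -/

namespace ManyTuran

open Finset
open scoped Classical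

variable {V : Type*} {s : ℕ}

/-- A set of spiders with length vector `j` in which, avoiding at most `N` given vertices, every
spider may be replaced by another one with the same leaves, and any of its leaves may be replaced by
another neighbour of the preceding vertex. -/
structure IsFlexible (G : SimpleGraph V) (j : Fin s → ℕ) (N : ℕ)
    (S : Finset (Fin s → ℕ → V)) : Prop where
  isSpider : ∀ p ∈ S, IsSpider G j p
  rechoose : ∀ p ∈ S, ∀ W : Finset V, #W ≤ N → ∃ q ∈ S, (∀ i, q i (j i) = p i (j i)) ∧
    ∀ i d, d < j i → q i d ∉ W
  change : ∀ p ∈ S, ∀ i, ∀ W : Finset V, #W ≤ N → ∃ q ∈ S, (∀ i', i' ≠ i → q i' = p i') ∧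
    (∀ d, d < j i → q i d = p i d) ∧ q i (j i) ∉ W

/-- Both replacement properties say that certain fibres are large: spiders with the same leaves, and
spiders differing in one leaf only. Tuples of leaves are few because each is frequent; spiders
lacking one leaf are few because they have one edge less and δ is large. So small fibres can be
removed. -/
theorem exists_isFlexible (hs : 0 < s) (m K A N g : ℕ) (hK : 1 ≤ K) (hA : 1 ≤ A) :
    ∃ f₀ d₀ : ℕ, ∀ {V : Type*} [Fintype V] (G : SimpleGraph V) [DecidableRel G.Adj] (δ Δ : ℕ)
      (j : Fin s → ℕ) (S : Finset (Fin s → ℕ → V)), 0 < Fintype.card V →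
      (∀ v, G.degree v ≤ Δ) → Δ ≤ K * δ → d₀ ≤ δ → (∀ i, 1 ≤ j i) → ∑ i, j i ≤ m →
      (∀ p ∈ S, IsSpider G j p) → Fintype.card V * δ ^ ∑ i, j i ≤ A * #S →
      (∀ p ∈ S, f₀ < #{q ∈ S | ∀ i, q i (j i) = p i (j i)}) →
      (∀ (v : Fin s → V) i d u, d < j i → #{q ∈ S | (∀ i, q i (j i) = v i) ∧ q i d = u} ≤ g) →
      ∃ T, T.Nonempty ∧ IsFlexible G j N T := by
  -- One more than the union bound over `m` positions and `N` forbidden vertices. The factors 4 in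
  -- both thresholds make the leaf tuples, and all the leaf deletions together, cost at most a
  -- quarter of `S` each.
  set f' := m * N * g + 1 with hf'
  set d₀ := 4 * A * s * (N + 1) * K ^ m with hd₀
  refine ⟨4 * f', d₀, ?_⟩
  intro V _ G _ δ Δ j S hn hΔ hKΔ hδ hj hjm hS hcard hf hgS
  have hδpos : 0 < δ := by
    have : 0 < d₀ := by positivity
    omega
  have hSpos : 0 < #S :=
    Nat.pos_of_mul_pos_left (a := A) ((Nat.mul_pos hn (pow_pos hδpos _)).trans_le hcard)
  set n := Fintype.card V
  have hjs : 1 ≤ ∑ i, j i :=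
    (hj ⟨0, hs⟩).trans (single_le_sum (f := j) (fun _ _ => Nat.zero_le _) (mem_univ _))
  let π : Option (Fin s) → (Fin s → ℕ → V) → Fin s → ℕ → V := fun o p =>
    o.elim (fun i _ => p i (j i)) fun i => trunc (Function.update j i (j i - 1)) p
  have hleafcard : 4 * (f' * #(S.image (π none))) ≤ #S := by
    rw [card_eq_sum_card_image (π none) S, ← mul_assoc, mul_comm, ← smul_eq_mul]
    refine card_nsmul_le_sum _ _ _ fun v hv => ?_
    obtain ⟨p, hp, rfl⟩ := mem_image.1 hv
    refine (hf p hp).le.trans (card_le_card ?_)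
    intro q hq
    obtain ⟨hq, hqp⟩ := mem_filter.1 hq
    refine mem_filter.2 ⟨hq, ?_⟩
    funext i d
    exact hqp i
  have htrunc : ∀ i, #(S.image (π (some i))) ≤ n * (K ^ m * δ ^ (∑ i, j i - 1)) := by
    intro i
    have hsum : ∑ a, Function.update j i (j i - 1) a + 1 = ∑ a, j a := by
      refine sum_add_one_of_update (i := i) ?_ fun a ha => Function.update_of_ne ha ..
      rw [Function.update_self]
      have := hj i
      omega
    have h1 := card_spiders_le hΔ hs (Function.update j i (j i - 1)) (S.image (π (some i))) (by
      intro p hp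
      obtain ⟨q, hq, rfl⟩ := mem_image.1 hp
      refine (hS q hq).trunc fun a => ?_
      by_cases ha : a = i
      · subst ha; simp
      · simp [ha])
    refine h1.trans (Nat.mul_le_mul_left _ ?_)
    rw [show ∑ a, Function.update j i (j i - 1) a = ∑ i, j i - 1 by omega]
    calc Δ ^ (∑ i, j i - 1) ≤ (K * δ) ^ (∑ i, j i - 1) := Nat.pow_le_pow_left hKΔ _
      _ = K ^ (∑ i, j i - 1) * δ ^ (∑ i, j i - 1) := mul_pow _ _ _
      _ ≤ _ := Nat.mul_le_mul_right _ (Nat.pow_le_pow_right hK (by omega))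
  have hsumtrunc : 4 * ∑ i, (N + 1) * #(S.image (π (some i))) ≤ #S := by
    have h1 : ∑ i, (N + 1) * #(S.image (π (some i))) ≤
        s * ((N + 1) * (n * (K ^ m * δ ^ (∑ i, j i - 1)))) := by
      refine (sum_le_card_nsmul univ _ _ fun i _ => Nat.mul_le_mul_left _ (htrunc i)).trans ?_
      simp
    refine Nat.le_of_mul_le_mul_left (le_trans ?_ hcard) hA
    calc A * (4 * ∑ i, (N + 1) * #(S.image (π (some i))))
        ≤ A * (4 * (s * ((N + 1) * (n * (K ^ m * δ ^ (∑ i, j i - 1)))))) := by gcongr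
      _ = n * (d₀ * δ ^ (∑ i, j i - 1)) := by rw [hd₀]; ring
      _ ≤ n * (δ * δ ^ (∑ i, j i - 1)) := by gcongr
      _ = n * δ ^ (∑ i, j i) := by rw [← pow_succ', Nat.sub_add_cancel hjs]
  obtain ⟨T, hTS, hT, hfib⟩ := exists_subset_fibers_large π
    (fun o => o.elim f' fun _ => N + 1) S (by
      rw [Fintype.sum_option]
      simp only [Option.elim]
      omega)
  refine ⟨T, hT, ⟨fun p hp => hS p (hTS hp), ?_, ?_⟩⟩
  · intro p hp W hW
    have h1 : f' ≤ #{q ∈ T | ∀ i, q i (j i) = p i (j i)} := by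
      refine (hfib none p hp).trans (card_le_card fun q hq => ?_)
      obtain ⟨hq, he⟩ := mem_filter.1 hq
      exact mem_filter.2 ⟨hq, fun i => congrFun (congrFun he i) 0⟩
    obtain ⟨q, hq, hqW⟩ := exists_forall_notMem {q ∈ T | ∀ i, q i (j i) = p i (j i)}
      (univ.sigma fun i => range (j i)) (fun q e => q e.1 e.2) W g (by
        rintro ⟨i, d⟩ hd q hq
        rw [mem_sigma, mem_range] at hd
        refine (card_le_card fun q' hq' => ?_).trans
          (hgS (fun i => p i (j i)) i d (q i d) hd.2)
        simp only [mem_filter] at hq' ⊢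
        exact ⟨hTS hq'.1.1, hq'.1.2, hq'.2⟩) (by
        rw [card_sigma]
        simp only [card_range]
        refine lt_of_lt_of_le ?_ h1
        rw [hf']
        exact Nat.lt_succ_of_le (Nat.mul_le_mul_right _ (Nat.mul_le_mul hjm hW)))
    obtain ⟨hqT, hqp⟩ := mem_filter.1 hq
    exact ⟨q, hqT, hqp, fun i d hd => hqW ⟨i, d⟩ (mem_sigma.2 ⟨mem_univ _, mem_range.2 hd⟩)⟩
  · intro p hp i W hW
    have hagree : ∀ q ∈ T, π (some i) q = π (some i) p →
        (∀ i', i' ≠ i → q i' = p i') ∧ ∀ d, d < j i → q i d = p i d := by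
      intro q hq he
      refine ⟨fun i' hi' => ?_, fun d hd => ?_⟩
      · funext d
        have := congrFun (congrFun he i') d
        simp only [π, Option.elim, trunc, Function.update_of_ne hi'] at this
        rw [(hS q (hTS hq)).stab, (hS p (hTS hp)).stab]
        exact this
      · have := congrFun (congrFun he i) d
        simp only [π, Option.elim, trunc, Function.update_self] at this
        rwa [min_eq_left (by omega)] at this
    by_contra! hc
    have h1 : #{q ∈ T | π (some i) q = π (some i) p} ≤ #W := by
      refine card_le_card_of_injOn (fun q => q i (j i)) ?_ ?_
      · intro q hq
        obtain ⟨hq, he⟩ := mem_filter.1 hq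
        exact hc q hq (hagree q hq he).1 (hagree q hq he).2
      · intro q hq q' hq' he'
        obtain ⟨hqT, he⟩ := mem_filter.1 hq
        obtain ⟨hqT', he2⟩ := mem_filter.1 hq'
        funext a d
        by_cases ha : a = i
        · subst ha
          rw [(hS q (hTS hqT)).stab, (hS q' (hTS hqT')).stab]
          by_cases hd : d < j a
          · rw [min_eq_left hd.le, (hagree q hqT he).2 d hd, (hagree q' hqT' he2).2 d hd]
          · rw [min_eq_right (by omega)]
            exact he'
        · rw [(hagree q hqT he).1 a ha, (hagree q' hqT' he2).1 a ha]
    have h2 := hfib (some i) p hp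
    simp only [Option.elim] at h2
    omega

section Flexible

variable {G : SimpleGraph V} {j : Fin s → ℕ} {N : ℕ} {S : Finset (Fin s → ℕ → V)}

/-- Several leaves of a spider in a flexible set may be changed. -/
theorem IsFlexible.exists_change (hS : IsFlexible G j N S) (W : Finset V) (hW : #W ≤ N)
    (I : Finset (Fin s)) (p : Fin s → ℕ → V) (hp : p ∈ S) :
    ∃ q ∈ S, (∀ i, i ∉ I → q i = p i) ∧
      ∀ i ∈ I, (∀ d, d < j i → q i d = p i d) ∧ q i (j i) ∉ W := by
  induction I using Finset.induction_on with
  | empty => exact ⟨p, hp, by simp, by simp⟩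
  | insert a I ha ih =>
    obtain ⟨q, hq, h1, h2⟩ := ih
    obtain ⟨q', hq', h1', h2', h3'⟩ := hS.change q hq a W hW
    refine ⟨q', hq', fun i hi => ?_, fun i hi => ?_⟩
    · rw [mem_insert, not_or] at hi
      rw [h1' i hi.1, h1 i hi.2]
    · rcases mem_insert.1 hi with rfl | hi
      · exact ⟨fun d hd => by rw [h2' d hd, h1 i ha], h3'⟩
      · rw [h1' i (fun h => ha (h ▸ hi))]
        exact h2 i hi

/-- A leaf of a spider in a flexible set may be moved along a path of even length. -/
theorem IsFlexible.exists_zigzag (hS : IsFlexible G j N S) (hj : ∀ i, 1 ≤ j i) (i : Fin s) (m : ℕ)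
    (p : Fin s → ℕ → V) (hp : p ∈ S) (W : Finset V) (hW : #W + 2 * m ≤ N) :
    ∃ (q : ℕ → V), ∃ y ∈ S, (∀ i', i' ≠ i → y i' (j i') = p i' (j i')) ∧ q 0 = p i (j i) ∧
      q (2 * m) = y i (j i) ∧ IsPathOn G (2 * m) q ∧ ∀ a, 0 < a → a ≤ 2 * m → q a ∉ W := by
  -- A state is a spider with its `i`-th leaf (even countdown) or the vertex before it (odd). The
  -- first is left by `rechoose`, the second by `change`; the other leaves never move.
  let M : ℕ → V × (Fin s → ℕ → V) → Prop := fun d e => e.2 ∈ S ∧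
    (∀ i', i' ≠ i → e.2 i' (j i') = p i' (j i')) ∧ e.1 = e.2 i (if Even d then j i else j i - 1)
  have hji := hj i
  have step : ∀ d x, M (d + 1) x → ∀ W : Finset V, #W ≤ N →
      ∃ y, M d y ∧ G.Adj x.1 y.1 ∧ y.1 ∉ W := by
    rintro d ⟨v, y⟩ ⟨hy, hleaf, hv⟩ W hW
    dsimp only at hy hleaf hv
    by_cases hd : Even d
    · have hd' : ¬ Even (d + 1) := by rwa [Nat.even_add_one, not_not]
      rw [if_neg hd'] at hv
      obtain ⟨q, hq, h1, h2, h3⟩ := hS.change y hy i W hW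
      refine ⟨(q i (j i), q), ⟨hq, fun i' hi' => ?_, by simp [hd]⟩, ?_, h3⟩
      · rw [← hleaf i' hi']
        exact congrFun (h1 i' hi') _
      · have := (hS.isSpider q hq).adj i (j i - 1) (by omega)
        rw [h2 _ (by omega), Nat.sub_add_cancel hji, ← hv] at this
        exact this
    · have hd' : Even (d + 1) := by rwa [Nat.even_add_one]
      rw [if_pos hd'] at hv
      obtain ⟨q, hq, h1, h2⟩ := hS.rechoose y hy W hW
      refine ⟨(q i (j i - 1), q), ⟨hq, fun i' hi' => ?_, by simp [hd]⟩, ?_, h2 i _ (by omega)⟩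
      · rw [← hleaf i' hi']
        exact h1 i'
      · have := (hS.isSpider q hq).adj i (j i - 1) (by omega)
        rw [Nat.sub_add_cancel hji, h1, ← hv] at this
        exact this.symm
  obtain ⟨q, y, ⟨hy, hleaf, hv⟩, h0, h1, hq, hqW⟩ := exists_path_of_states G Prod.fst M N step
    (2 * m) 0 (p i (j i), p) ⟨hp, fun _ _ => rfl, by simp⟩ W hW
  exact ⟨q, y.2, hy, hleaf, h0, by rw [h1, hv]; simp, hq, hqW⟩

/-- Several leaves of a spider in a flexible set may be moved along disjoint paths of even
lengths. -/
theorem IsFlexible.exists_zigzags (hS : IsFlexible G j N S) (hj : ∀ i, 1 ≤ j i) (m : Fin s → ℕ)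
    (I : Finset (Fin s)) (p : Fin s → ℕ → V) (hp : p ∈ S) (W : Finset V)
    (hpW : ∀ i, p i (j i) ∈ W) (hW : #W + ∑ i ∈ I, (2 * m i + 1) ≤ N) :
    ∃ (q : Fin s → ℕ → V), ∃ y ∈ S, (∀ i, i ∉ I → y i (j i) = p i (j i)) ∧
      (∀ i ∈ I, q i 0 = p i (j i) ∧ q i (2 * m i) = y i (j i) ∧ IsPathOn G (2 * m i) (q i) ∧
        ∀ a, 0 < a → a ≤ 2 * m i → q i a ∉ W) ∧
      ∀ i ∈ I, ∀ i' ∈ I, i ≠ i' → ∀ a a', a ≤ 2 * m i → a' ≤ 2 * m i' → q i a ≠ q i' a' := by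
  induction I using Finset.induction_on generalizing p W with
  | empty => exact ⟨p, p, hp, by simp, by simp, by simp⟩
  | insert b I hb ih =>
    rw [sum_insert hb] at hW
    obtain ⟨q₁, y₁, hy₁, hleaf₁, h0₁, h1₁, hq₁, hqW₁⟩ :=
      hS.exists_zigzag hj b (m b) p hp W (by omega)
    have hc : #(W ∪ (range (2 * m b + 1)).image q₁) ≤ #W + (2 * m b + 1) :=
      (card_union_le _ _).trans (Nat.add_le_add_left (card_image_le.trans (by simp)) _)
    obtain ⟨q, y, hy, hleaf, hq, hne⟩ := ih y₁ hy₁ (W ∪ (range (2 * m b + 1)).image q₁) (by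
      intro i
      by_cases hi : i = b
      · subst hi
        rw [← h1₁]
        exact mem_union_right _ (mem_image_of_mem _ (mem_range.2 (by omega)))
      · rw [hleaf₁ i hi]
        exact mem_union_left _ (hpW i)) (by omega)
    have hib : ∀ i ∈ I, i ≠ b := fun i hi h => hb (h ▸ hi)
    have hcross : ∀ i ∈ I, ∀ a a', a ≤ 2 * m b → a' ≤ 2 * m i → q₁ a ≠ q i a' := by
      intro i hi a a' ha ha' he
      rcases Nat.eq_zero_or_pos a' with rfl | h'
      · rw [(hq i hi).1, hleaf₁ i (hib i hi)] at he
        rcases Nat.eq_zero_or_pos a with rfl | h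
        · rw [h0₁] at he
          have h3 := (hS.isSpider p hp).inj _ _ _ _ le_rfl le_rfl he
          rcases h3.2 with h4 | h4
          · have := hj b
            omega
          · exact hib i hi h4.symm
        · exact hqW₁ a h ha (he ▸ hpW i)
      · refine (hq i hi).2.2.2 a' h' ha' (mem_union_right _ ?_)
        rw [← he]
        exact mem_image_of_mem _ (mem_range.2 (by omega))
    refine ⟨Function.update q b q₁, y, hy, ?_, ?_, ?_⟩
    · intro i hi
      rw [mem_insert, not_or] at hi
      rw [hleaf i hi.2, hleaf₁ i hi.1]
    · intro i hi
      rcases mem_insert.1 hi with rfl | hi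
      · rw [Function.update_self]
        exact ⟨h0₁, by rw [h1₁, hleaf i hb], hq₁, hqW₁⟩
      · rw [Function.update_of_ne (hib i hi)]
        refine ⟨by rw [(hq i hi).1, hleaf₁ i (hib i hi)], (hq i hi).2.1, (hq i hi).2.2.1, ?_⟩
        exact fun a h0 ha hm => (hq i hi).2.2.2 a h0 ha (mem_union_left _ hm)
    · intro i hi i' hi' hii a a' ha ha'
      rcases mem_insert.1 hi with h | hiI <;> rcases mem_insert.1 hi' with h' | hiI'
      · exact absurd (h.trans h'.symm) hii
      · subst h
        rw [Function.update_self, Function.update_of_ne (hib i' hiI')]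
        exact hcross i' hiI' a a' ha ha'
      · subst h'
        rw [Function.update_self, Function.update_of_ne (hib i hiI)]
        exact (hcross i hiI a' a ha' ha).symm
      · rw [Function.update_of_ne (hib i hiI), Function.update_of_ne (hib i' hiI')]
        exact hne i hiI i' hiI' hii a a' ha ha'

/-- The legs of a flexible set of spiders can be lengthened. -/
theorem IsFlexible.exists_isRobust {L : Fin s → ℕ} {N' : ℕ} (hS : IsFlexible G j N S)
    (hs : 0 < s) (hne : S.Nonempty) (hj : ∀ i, 1 ≤ j i) (hjL : ∀ i, j i ≤ L i)
    (hodd : ∀ i i', i ≠ i' → j i = 1 → j i' = 1 → ¬ (Odd (L i - j i) ∧ Odd (L i' - j i')))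
    (hN : N' + 3 * s + ∑ i, L i ≤ N) : ∃ x, IsRobust G L N' x := by
  obtain ⟨p₀, hp₀⟩ := hne
  let m : Fin s → ℕ := fun i => (L i - j i) / 2
  -- The leaves of the long spider. When the missing length is odd, the extension starts one vertex
  -- before the leaf; two such vertices coincide only at the center, which `hodd` excludes.
  let x : Fin s → V := fun i => p₀ i (if Odd (L i - j i) then j i - 1 else j i)
  have hx : Function.Injective x := by
    intro i i' he
    by_contra hii
    have h := (hS.isSpider p₀ hp₀).inj i i' _ _ (by split_ifs <;> omega)
      (by split_ifs <;> omega) he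
    have h1 := hj i
    have h2 := hj i'
    have h3 := hodd i i' hii
    rcases h.2 with h4 | h4
    · rw [h4] at h
      split_ifs at h h4 with h5 h6
      · exact h3 (by omega) (by omega) ⟨h6, h5⟩
      · omega
      · omega
      · omega
    · exact hii h4
  have hm : ∑ i, (2 * m i + 1) ≤ ∑ i, L i + s := by
    calc ∑ i, (2 * m i + 1) ≤ ∑ i, (L i + 1) := sum_le_sum fun i _ => by simp only [m]; omega
      _ = _ := by simp [sum_add_distrib]
  refine ⟨x, fun X hX => ?_⟩
  have himx : #(univ.image x) ≤ s := card_image_le.trans (by simp)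
  have hXx : #(X ∪ univ.image x) ≤ N' + s := (card_union_le _ _).trans (by omega)
  -- On legs of odd deficit a fresh leaf provides the first step away from `x i`; zigzags of length
  -- `2 * m i` provide the rest.
  obtain ⟨p, hp, hp1, hp2⟩ := hS.exists_change (X ∪ univ.image x) (by omega)
    (univ.filter fun i => Odd (L i - j i)) p₀ hp₀
  have hleafcard : #(univ.image fun i => p i (j i)) ≤ s := card_image_le.trans (by simp)
  obtain ⟨q, y, hy, -, hq, hqne⟩ := hS.exists_zigzags hj m univ p hp
    (X ∪ univ.image x ∪ univ.image fun i => p i (j i))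
    (fun i => mem_union_right _ (mem_image_of_mem (fun i => p i (j i)) (mem_univ i))) (by
      have := card_union_le (X ∪ univ.image x) (univ.image fun i => p i (j i))
      omega)
  have hqcard := card_spiderVerts_le (fun i => 2 * m i) q
  rw [sum_add_distrib] at hm
  simp only [sum_const, card_univ, Fintype.card_fin, smul_eq_mul, mul_one] at hm
  -- The inner spider is chosen last: it ends where the zigzags end and otherwise avoids them.
  obtain ⟨z, hz, hzy, hzW⟩ := hS.rechoose y hy
    (X ∪ univ.image x ∪ spiderVerts (fun i => 2 * m i) q) (by
      have := card_union_le (X ∪ univ.image x) (spiderVerts (fun i => 2 * m i) q)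
      omega)
  let t : Fin s → ℕ → V := fun i d =>
    if Odd (L i - j i) then (if d = 0 then x i else q i (d - 1)) else q i d
  have hodd' : ∀ i, Odd (L i - j i) → L i - j i = 2 * m i + 1 := by
    intro i hi
    obtain ⟨c, hc⟩ := hi
    simp only [m]
    omega
  have heven' : ∀ i, ¬ Odd (L i - j i) → L i - j i = 2 * m i := by
    intro i hi
    obtain ⟨c, hc⟩ := Nat.not_odd_iff_even.1 hi
    simp only [m]
    omega
  have hxeven : ∀ i, ¬ Odd (L i - j i) → p i (j i) = x i := by
    intro i hi
    simp only [x, if_neg hi]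
    rw [hp1 i (by simpa using hi)]
  have hxodd : ∀ i, Odd (L i - j i) → p i (j i - 1) = x i := by
    intro i hi
    have := hj i
    simp only [x, if_pos hi]
    exact (hp2 i (by simpa using hi)).1 _ (by omega)
  have ht0 : ∀ i, t i 0 = x i := by
    intro i
    by_cases hi : Odd (L i - j i)
    · simp [t, hi]
    · simp only [t, if_neg hi]
      rw [(hq i (mem_univ _)).1, hxeven i hi]
  have htr : ∀ i, t i (L i - j i) = z i (j i) := by
    intro i
    rw [hzy, ← (hq i (mem_univ _)).2.1]
    by_cases hi : Odd (L i - j i)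
    · have := hodd' i hi
      simp only [t, if_pos hi]
      rw [if_neg (by omega), this, Nat.add_sub_cancel]
    · simp only [t, if_neg hi, heven' i hi]
  have htq : ∀ i a, 0 < a → a ≤ L i - j i → ∃ a' ≤ 2 * m i, t i a = q i a' := by
    intro i a h0 ha
    by_cases hi : Odd (L i - j i)
    · have := hodd' i hi
      exact ⟨a - 1, by omega, by simp only [t, if_pos hi]; rw [if_neg (by omega)]⟩
    · have := heven' i hi
      exact ⟨a, by omega, by simp only [t, if_neg hi]⟩
  have htX : ∀ i a, 0 < a → a ≤ L i - j i → t i a ∉ X ∪ univ.image x := by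
    intro i a h0 ha hmem
    by_cases hi : Odd (L i - j i)
    · have := hodd' i hi
      simp only [t, if_pos hi] at hmem
      rw [if_neg (by omega)] at hmem
      rcases Nat.eq_zero_or_pos (a - 1) with h | h
      · rw [h, (hq i (mem_univ _)).1] at hmem
        exact (hp2 i (by simpa using hi)).2 hmem
      · exact (hq i (mem_univ _)).2.2.2 (a - 1) h (by omega) (mem_union_left _ hmem)
    · have := heven' i hi
      simp only [t, if_neg hi] at hmem
      exact (hq i (mem_univ _)).2.2.2 a h0 (by omega) (mem_union_left _ hmem)
  have htpath : ∀ i, IsPathOn G (L i - j i) (t i) := by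
    intro i
    have hqi := (hq i (mem_univ _)).2.2.1
    by_cases hi : Odd (L i - j i)
    · have hr := hodd' i hi
      have hji := hj i
      refine ⟨fun a ha => ?_, fun a a' ha ha' he => ?_⟩
      · simp only [t, if_pos hi]
        rw [if_neg (Nat.succ_ne_zero a), Nat.add_sub_cancel]
        split_ifs with h
        · rw [h, (hq i (mem_univ _)).1, ← hxodd i hi]
          have := (hS.isSpider p hp).adj i (j i - 1) (by omega)
          rwa [Nat.sub_add_cancel hji] at this
        · have := hqi.adj (a - 1) (by omega)
          rwa [Nat.sub_add_cancel (by omega)] at this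
      · have hx0 : ∀ a, 0 < a → a ≤ L i - j i → t i a ≠ x i := fun a h0 ha he =>
          htX i a h0 ha (mem_union_right _ (he ▸ mem_image_of_mem _ (mem_univ _)))
        rcases Nat.eq_zero_or_pos a with rfl | h <;> rcases Nat.eq_zero_or_pos a' with rfl | h'
        · rfl
        · rw [ht0] at he
          exact absurd he.symm (hx0 a' h' ha')
        · rw [ht0] at he
          exact absurd he (hx0 a h ha)
        · simp only [t, if_pos hi] at he
          rw [if_neg (by omega), if_neg (by omega)] at he
          have := hqi.inj _ _ (by omega) (by omega) he
          omega
    · have hr := heven' i hi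
      have : t i = q i := by
        funext d
        simp only [t, if_neg hi]
      rw [this, hr]
      exact hqi
  have htne : ∀ i i' a a', i ≠ i' → a ≤ L i - j i → a' ≤ L i' - j i' → t i a ≠ t i' a' := by
    intro i i' a a' hii ha ha' he
    rcases Nat.eq_zero_or_pos a with rfl | h <;> rcases Nat.eq_zero_or_pos a' with rfl | h'
    · rw [ht0, ht0] at he
      exact hii (hx he)
    · rw [ht0] at he
      exact htX i' a' h' ha' (mem_union_right _ (he ▸ mem_image_of_mem _ (mem_univ _)))
    · rw [ht0] at he
      exact htX i a h ha (mem_union_right _ (he ▸ mem_image_of_mem _ (mem_univ _)))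
    · obtain ⟨c, hc, hc'⟩ := htq i a h ha
      obtain ⟨e, hle, he'⟩ := htq i' a' h' ha'
      rw [hc', he'] at he
      exact hqne i (mem_univ _) i' (mem_univ _) hii c e hc hle he
  have hzt : ∀ i i' d a, d < j i → a ≤ L i' - j i' → z i d ≠ t i' a := by
    intro i i' d a hd ha he
    refine hzW i d hd ?_
    rw [he]
    rcases Nat.eq_zero_or_pos a with rfl | h
    · rw [ht0]
      exact mem_union_left _ (mem_union_right _ (mem_image_of_mem _ (mem_univ _)))
    · obtain ⟨c, hc, hc'⟩ := htq i' a h ha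
      rw [hc']
      exact mem_union_right _ (mem_spiderVerts (j := fun i => 2 * m i) hc)
  have hzS := hS.isSpider z hz
  let P : Fin s → ℕ → V := fun i d =>
    if d ≤ j i then z i d else t i (L i - j i - (d - j i))
  have hleg : ∀ i, IsPathOn G (L i) (P i) := by
    intro i
    have hzi : IsPathOn G (j i) (z i) :=
      ⟨hzS.adj i, fun a a' ha ha' he => (hzS.inj i i a a' ha ha' he).1⟩
    have := hzi.append (htpath i).reverse (by simpa using (htr i).symm) (by
      intro a d ha hd hdl he
      rcases ha.lt_or_eq with h | rfl
      · exact hzt i i a _ h (by omega) he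
      · rw [← htr] at he
        have := (htpath i).inj _ _ le_rfl (by omega) he
        omega)
    rwa [Nat.add_sub_cancel' (hjL i)] at this
  have hcross : ∀ i i' d a, i ≠ i' → d ≤ j i → a ≤ L i' - j i' → z i d ≠ t i' a := by
    intro i i' d a hii hd ha
    rcases hd.lt_or_eq with h | rfl
    · exact hzt i i' d a h ha
    · rw [← htr]
      exact htne i i' _ _ hii le_rfl ha
  have hend : ∀ i d, d ≤ L i → j i ≤ d → P i d = t i (L i - d) := by
    intro i d hd hjd
    rcases hjd.lt_or_eq with h | rfl
    · simp only [P]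
      rw [if_neg (by omega)]
      congr 1
      omega
    · simp only [P, le_refl, if_true]
      exact (htr i).symm
  have hstart : ∀ i d, d ≤ j i → P i d = z i d := fun i d hd => if_pos hd
  refine ⟨_, isSpider_of_legs (c := z ⟨0, hs⟩ 0) ?_ hleg ?_, ?_, ?_⟩
  · intro i
    rw [hstart i 0 (Nat.zero_le _)]
    exact hzS.center _ _
  · intro i i' d d' hii h0 hd h0' hd'
    rcases le_total d (j i) with h | h <;> rcases le_total d' (j i') with h' | h'
    · rw [hstart i d h, hstart i' d' h']
      intro he
      rcases (hzS.inj _ _ _ _ h h' he).2 with h3 | h3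
      · omega
      · exact hii h3
    · rw [hstart i d h, hend i' d' hd' h']
      exact hcross i i' d _ hii h (by omega)
    · rw [hend i d hd h, hstart i' d' h']
      exact (hcross i' i d' _ hii.symm h' (by omega)).symm
    · rw [hend i d hd h, hend i' d' hd' h']
      exact htne i i' _ _ hii (by omega) (by omega)
  · intro i
    simp only [min_self]
    rw [hend i _ le_rfl (hjL i), Nat.sub_self, ht0]
  · intro i d hd
    rw [min_eq_left hd.le]
    rcases lt_or_ge d (j i) with h | h
    · rw [hstart i d h.le]
      exact fun hm => hzW i d h (mem_union_left _ (mem_union_left _ hm))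
    · rw [hend i d hd.le h]
      exact fun hm => htX i (L i - d) (by omega) (by omega) (mem_union_left _ hm)

end Flexible

end ManyTuran

/-! ### Rare and frequent restrictions -/

namespace ManyTuran

open Finset
open scoped Classical

/-- At least half of the elements have restrictions that are all rare or all frequent among the
restrictions with the same ends. -/
theorem exists_rare_or_frequent {α β γ : Type*} [DecidableEq β] (ρ : α → β) (e : β → γ) (f : ℕ) (S : Finset α) :
    ∃ T ⊆ S, #S ≤ 2 * #T ∧ ((∀ c, #{q ∈ T.image ρ | e q = c} ≤ f) ∨
      ∀ q ∈ T.image ρ, f < #{q' ∈ T.image ρ | e q' = e q}) := by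
  -- The criterion depends only on the ends, so restrictions with the same ends fall into the same
  -- part and `S₂` loses no frequency.
  set S₁ := S.filter (fun p => #{q ∈ S.image ρ | e q = e (ρ p)} ≤ f)
  set S₂ := S.filter (fun p => ¬ #{q ∈ S.image ρ | e q = e (ρ p)} ≤ f)
  have hsplit : #S₁ + #S₂ = #S := card_filter_add_card_filter_not _
  rcases le_total #S₂ #S₁ with h | h
  · refine ⟨S₁, filter_subset _ _, by omega, Or.inl fun c => ?_⟩
    rcases ({q ∈ S₁.image ρ | e q = c}).eq_empty_or_nonempty with h0 | ⟨q, hq⟩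
    · simp [h0]
    · obtain ⟨hqT, rfl⟩ := mem_filter.1 hq
      obtain ⟨p, hp, rfl⟩ := mem_image.1 hqT
      refine (card_le_card ?_).trans (mem_filter.1 hp).2
      exact filter_subset_filter _ (image_subset_image (filter_subset _ _))
  · refine ⟨S₂, filter_subset _ _, by omega, Or.inr fun q hq => ?_⟩
    obtain ⟨p, hp, rfl⟩ := mem_image.1 hq
    refine (not_le.1 (mem_filter.1 hp).2).trans_le (card_le_card fun q' hq' => ?_)
    obtain ⟨hq', he⟩ := mem_filter.1 hq'
    obtain ⟨p', hp', rfl⟩ := mem_image.1 hq'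
    refine mem_filter.2 ⟨mem_image_of_mem _ (mem_filter.2 ⟨hp', ?_⟩), he⟩
    rw [he]
    exact (mem_filter.1 hp).2

section Restrictions

variable {V : Type*} {s : ℕ} {G : SimpleGraph V} {L : Fin s → ℕ}

theorem IsSpider.isPathOn_seg {p : Fin s → ℕ → V} (hp : IsSpider G L p) {i : Fin s} {a l : ℕ}
    (h : a + l ≤ L i) : IsPathOn G l (seg i a l p) where
  adj d hd := by
    simp only [seg]
    rw [min_eq_left (by omega), min_eq_left (by omega)]
    exact hp.adj i (a + d) (by omega)
  inj d d' hd hd' he := by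
    simp only [seg, min_eq_left hd, min_eq_left hd'] at he
    have := (hp.inj i i _ _ (by omega) (by omega) he).1
    omega

theorem IsSpider.isPathOn_bend {p : Fin s → ℕ → V} (hp : IsSpider G L p) {i i' : Fin s}
    (hii : i ≠ i') (hL : ∀ i, 1 ≤ L i) : IsPathOn G 2 (bend i i' p) where
  adj d hd := by
    have h1 := hp.adj i 0 (hL i)
    have h2 := hp.adj i' 0 (hL i')
    rw [hp.center i' i] at h2
    interval_cases d
    · simpa [bend] using h1.symm
    · simpa [bend] using h2
  inj d d' hd hd' he := by
    have h1 : p i 1 ≠ p i 0 := fun h => by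
      simpa using (hp.inj i i _ _ (hL i) (Nat.zero_le _) h).1
    have h2 : p i' 1 ≠ p i 0 := fun h => by
      simpa using (hp.inj i' i _ _ (hL i') (Nat.zero_le _) h).1
    have h3 : p i 1 ≠ p i' 1 := fun h => by
      simpa [hii] using (hp.inj i i' _ _ (hL i) (hL i') h).2
    interval_cases d <;> interval_cases d' <;> simp_all [bend]

/-- The vertex `v` cuts the segment into two shorter ones with prescribed ends. -/
theorem card_seg_through_le (S : Finset (Fin s → ℕ → V)) (i : Fin s) (a l d f : ℕ) (hdl : d ≤ l)
    (h1 : ∀ y x, #{q ∈ S.image (seg i a d) | q 0 = y ∧ q d = x} ≤ f)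
    (h2 : ∀ y x, #{q ∈ S.image (seg i (a + d) (l - d)) | q 0 = y ∧ q (l - d) = x} ≤ f)
    (y x v : V) : #{q ∈ S.image (seg i a l) | q 0 = y ∧ q l = x ∧ q d = v} ≤ f ^ 2 := by
  refine le_trans (b := #({q ∈ S.image (seg i a d) | q 0 = y ∧ q d = v} ×ˢ
    {q ∈ S.image (seg i (a + d) (l - d)) | q 0 = v ∧ q (l - d) = x})) ?_ ?_
  · refine card_le_card_of_injOn
      (fun q => (fun e => q (min e d), fun e => q (d + min e (l - d)))) ?_ ?_
    · intro q hq
      obtain ⟨hq, h0, hl, hd⟩ := mem_filter.1 hq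
      obtain ⟨p, hp, rfl⟩ := mem_image.1 hq
      refine mem_product.2 ⟨mem_filter.2 ⟨mem_image.2 ⟨p, hp, ?_⟩, ?_, ?_⟩,
        mem_filter.2 ⟨mem_image.2 ⟨p, hp, ?_⟩, ?_, ?_⟩⟩
      · funext e
        simp only [seg]
        congr 1
        omega
      · simpa using h0
      · simpa using hd
      · funext e
        simp only [seg]
        congr 1
        omega
      · simpa using hd
      · simpa [Nat.add_sub_cancel' hdl] using hl
    · intro q hq q' hq' he
      obtain ⟨hq, -⟩ := mem_filter.1 hq
      obtain ⟨p, hp, rfl⟩ := mem_image.1 hq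
      obtain ⟨hq', -⟩ := mem_filter.1 hq'
      obtain ⟨p', hp', rfl⟩ := mem_image.1 hq'
      have he1 := (Prod.ext_iff.1 he).1
      have he2 := (Prod.ext_iff.1 he).2
      funext e
      rcases le_total e d with h | h
      · have := congrFun he1 e
        simpa only [min_eq_left h] using this
      · have := congrFun he2 (e - d)
        simp only [seg] at this ⊢
        rw [show min (d + min (e - d) (l - d)) l = min e l by omega] at this
        exact this
  · rw [card_product, sq]
    exact Nat.mul_le_mul (h1 y v) (h2 v x)

/-- Once the center is fixed, each leg is a segment with prescribed ends. -/
theorem card_trunc_through_center_le (S : Finset (Fin s → ℕ → V)) (hS : ∀ p ∈ S, IsSpider G L p)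
    (j : Fin s → ℕ) (f : ℕ)
    (h : ∀ i y x, #{q ∈ S.image (seg i 0 (j i)) | q 0 = y ∧ q (j i) = x} ≤ f)
    (v : Fin s → V) (i₀ : Fin s) (u : V) :
    #{q ∈ S.image (trunc j) | (∀ i, q i (j i) = v i) ∧ q i₀ 0 = u} ≤ f ^ s := by
  refine le_trans (b := #(Fintype.piFinset fun i =>
    {q ∈ S.image (seg i 0 (j i)) | q 0 = u ∧ q (j i) = v i})) ?_ ?_
  · refine card_le_card fun q hq => ?_
    obtain ⟨hq, hv, hu⟩ := mem_filter.1 hq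
    obtain ⟨p, hp, rfl⟩ := mem_image.1 hq
    refine Fintype.mem_piFinset.2 fun i => mem_filter.2 ⟨mem_image.2 ⟨p, hp, ?_⟩, ?_, hv i⟩
    · funext e
      simp [seg, trunc]
    · rw [← hu]
      simpa [trunc] using (hS p hp).center i i₀
  · rw [Fintype.card_piFinset]
    refine (prod_le_pow_card _ _ f fun i _ => h i u (v i)).trans (by simp)

/-- The vertex `u` cuts the subspider into a smaller one, having `u` as a leaf, and the rest of the
leg. -/
theorem card_trunc_through_le (S : Finset (Fin s → ℕ → V)) (j : Fin s → ℕ) (i : Fin s) (d f : ℕ) (hd : d ≤ j i)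
    (h1 : ∀ v : Fin s → V, #{q ∈ S.image (trunc (Function.update j i d)) |
      ∀ a, q a (Function.update j i d a) = v a} ≤ f)
    (h2 : ∀ y x, #{q ∈ S.image (seg i d (j i - d)) | q 0 = y ∧ q (j i - d) = x} ≤ f)
    (v : Fin s → V) (u : V) :
    #{q ∈ S.image (trunc j) | (∀ a, q a (j a) = v a) ∧ q i d = u} ≤ f ^ 2 := by
  refine le_trans (b := #({q ∈ S.image (trunc (Function.update j i d)) |
      ∀ a, q a (Function.update j i d a) = Function.update v i u a} ×ˢ
    {q ∈ S.image (seg i d (j i - d)) | q 0 = u ∧ q (j i - d) = v i})) ?_ ?_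
  · refine card_le_card_of_injOn
      (fun q => (trunc (Function.update j i d) q, fun e => q i (d + min e (j i - d)))) ?_ ?_
    · intro q hq
      obtain ⟨hq, hv, hu⟩ := mem_filter.1 hq
      obtain ⟨p, hp, rfl⟩ := mem_image.1 hq
      refine mem_product.2 ⟨mem_filter.2 ⟨mem_image.2 ⟨p, hp, ?_⟩, ?_⟩,
        mem_filter.2 ⟨mem_image.2 ⟨p, hp, ?_⟩, ?_, ?_⟩⟩
      · refine (trunc_trunc (fun a => ?_) p).symm
        by_cases ha : a = i
        · subst ha; simpa using hd
        · simp [ha]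
      · intro a
        by_cases ha : a = i
        · subst ha
          simpa [trunc] using hu
        · simpa [trunc, ha] using hv a
      · funext e
        simp only [seg, trunc]
        congr 1
        omega
      · simpa using hu
      · simpa [Nat.add_sub_cancel' hd] using hv i
    · intro q hq q' hq' he
      obtain ⟨hq, -⟩ := mem_filter.1 hq
      obtain ⟨p, hp, rfl⟩ := mem_image.1 hq
      obtain ⟨hq', -⟩ := mem_filter.1 hq'
      obtain ⟨p', hp', rfl⟩ := mem_image.1 hq'
      have he1 := (Prod.ext_iff.1 he).1
      have he2 := (Prod.ext_iff.1 he).2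
      funext a e
      by_cases ha : a = i
      · subst ha
        rcases le_total e d with h | h
        · have := congrFun (congrFun he1 a) e
          simpa [trunc, min_eq_left h] using this
        · have := congrFun he2 (e - d)
          simp only [trunc] at this ⊢
          rw [show min (d + min (e - d) (j a - d)) (j a) = min e (j a) by omega] at this
          exact this
      · have := congrFun (congrFun he1 a) e
        simpa [trunc, ha] using this
  · rw [card_product, sq]
    exact Nat.mul_le_mul (h1 _) (h2 _ _)

/-- Two leaves adjacent to the center are joined by a two-edge path through it. As these are rare,
the leaves leave few centers, and each center leaves few choices of legs. -/
theorem card_trunc_le_of_bend (S : Finset (Fin s → ℕ → V)) (hS : ∀ p ∈ S, IsSpider G L p)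
    (j : Fin s → ℕ) (f : ℕ)
    (h : ∀ i y x, #{q ∈ S.image (seg i 0 (j i)) | q 0 = y ∧ q (j i) = x} ≤ f)
    {i i' : Fin s} (hi : j i = 1) (hi' : j i' = 1)
    (hb : ∀ y x, #{q ∈ S.image (bend i i') | q 0 = y ∧ q 2 = x} ≤ f) (v : Fin s → V) :
    #{q ∈ S.image (trunc j) | ∀ a, q a (j a) = v a} ≤ f ^ (s + 1) := by
  set C := {q ∈ S.image (trunc j) | ∀ a, q a (j a) = v a} with hC
  have h1 : #C ≤ f ^ s * #(C.image fun q => q i 0) := by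
    refine card_le_mul_card_image C _ fun u _ => ?_
    rw [hC, filter_filter]
    exact card_trunc_through_center_le S hS j f h v i u
  have h2 : #(C.image fun q => q i 0) ≤ f := by
    refine le_trans (card_le_card fun u hu => ?_)
      (card_image_le.trans (hb (v i) (v i'))) (b := #(image (fun q => q 1) _))
    obtain ⟨q, hq, rfl⟩ := mem_image.1 hu
    obtain ⟨hq, hv⟩ := mem_filter.1 hq
    obtain ⟨p, hp, rfl⟩ := mem_image.1 hq
    refine mem_image.2 ⟨bend i i' p, mem_filter.2 ⟨mem_image_of_mem _ hp, ?_, ?_⟩, ?_⟩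
    · simpa [bend, trunc, hi] using hv i
    · simpa [bend, trunc, hi'] using hv i'
    · simp [bend, trunc]
  calc #C ≤ f ^ s * f := h1.trans (Nat.mul_le_mul_left _ h2)
    _ = _ := (pow_succ _ _).symm

end Restrictions

/-! ### Thinning out the set of spiders -/

theorem lengthVector_le {s b k : ℕ} (hbk : b ≤ k) (i : Fin s) : lengthVector s b k i ≤ k := by
  unfold lengthVector
  split_ifs
  · exact hbk
  · exact le_rfl

theorem one_le_lengthVector {s b k : ℕ} (hb : 1 ≤ b) (hbk : b ≤ k) (i : Fin s) :
    1 ≤ lengthVector s b k i := by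
  unfold lengthVector
  split_ifs <;> omega

theorem sum_lengthVector (s b k : ℕ) : ∑ i, lengthVector (s + 1) b k i = s * k + b := by
  rw [Fin.sum_univ_succ]
  simp [lengthVector, add_comm]

/-- In an almost regular graph without robustly connected leaves, the trivial lower bound on the
number of spiders is at most a constant times the number of tuples of leaves. -/
theorem exists_card_mul_pow_le {s b k : ℕ} (hs : 0 < s) (hb : 1 ≤ b) (hbk : b ≤ k) (K N : ℕ)
    (hK : 1 ≤ K) :
    ∃ d₀ A : ℕ, ∀ {V : Type*} [Fintype V] (G : SimpleGraph V) [DecidableRel G.Adj] (δ Δ : ℕ),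
      0 < Fintype.card V → (∀ v, δ ≤ G.degree v) → (∀ v, G.degree v ≤ Δ) → Δ ≤ K * δ → d₀ ≤ δ →
      (∀ x, ¬ IsRobust G (lengthVector s b k) N x) →
      Fintype.card V * δ ^ ∑ i, lengthVector s b k i ≤ A * Fintype.card V ^ s := by
  set L := lengthVector s b k with hLdef
  have hLk : ∀ i, L i ≤ k := lengthVector_le hbk
  have hL1 : ∀ i, 1 ≤ L i := one_le_lengthVector hb hbk
  set m := ∑ i, L i with hm
  have hsm : s ≤ m := by
    calc s = ∑ _i : Fin s, 1 := by simp
      _ ≤ m := sum_le_sum fun i _ => hL1 i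
  let ι := (Fin s × Fin (k + 1) × Fin (k + 1)) ⊕ (Fin s × Fin s) ⊕ (Fin s → Fin (k + 1))
  -- The factors come from counting spiders, from the refinement, from the current halving and from
  -- Δ ≤ Kδ. `A` depends on the number of conditions but not on their thresholds, which may thus be
  -- chosen afterwards.
  set A := 2 ^ m * (2 ^ Fintype.card ι * 2) * K ^ m with hA
  have hApos : 1 ≤ A := Nat.succ_le_of_lt (by positivity)
  choose φ D HP using fun g => exists_isRobust_of_many_paths (s := s) (k := k) hs hb K A N g hK hApos
  choose φ' D' HS using fun g =>
    exists_isFlexible (s := s) hs m K A (N + 3 * s + m) g hK hApos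
  -- Rarity threshold at each rank. The power `s + 2` dominates the bounds with exponents 2, `s` and
  -- `s + 1` on restrictions through a vertex or around two legs of length 1. The start uses `g =
  -- 1`, since three vertices determine a two-edge path.
  let F : ℕ → ℕ := fun r => Nat.rec (φ 1 + 1)
    (fun _ x => φ (x ^ (s + 2)) + φ' (x ^ (s + 2)) + x ^ (s + 2) + 1) r
  have hF0 : F 0 = φ 1 + 1 := rfl
  have hFs : ∀ r, F (r + 1) =
      φ (F r ^ (s + 2)) + φ' (F r ^ (s + 2)) + F r ^ (s + 2) + 1 := fun _ => rfl
  have hF1 : ∀ r, 1 ≤ F r := by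
    rintro (_ | r)
    · rw [hF0]; omega
    · rw [hFs]; omega
  have hFmono : Monotone F := by
    refine monotone_nat_of_le_succ fun r => ?_
    rw [hFs]
    have : F r ≤ F r ^ (s + 2) := Nat.le_self_pow (by omega) _
    omega
  have hFpow : ∀ r e, e ≤ s + 2 → F r ^ e ≤ F r ^ (s + 2) := fun r e he =>
    Nat.pow_le_pow_right (hF1 r) he
  set d₀ := ∑ r ∈ range (k + 1 + m), (D (F r ^ (s + 2)) + D' (F r ^ (s + 2))) + D 1 + 2 * (m + s)
    with hd₀
  have hD : ∀ r < k + 1 + m, D (F r ^ (s + 2)) ≤ d₀ ∧ D' (F r ^ (s + 2)) ≤ d₀ := by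
    intro r hr
    have := single_le_sum (f := fun r => D (F r ^ (s + 2)) + D' (F r ^ (s + 2)))
      (fun _ _ => Nat.zero_le _) (mem_range.2 hr)
    omega
  refine ⟨d₀, A * F (k + 1 + m), ?_⟩
  intro V _ G _ δ Δ hn hδG hΔ hKΔ hδ hrob
  have hδpos : 0 < δ := by omega
  set n := Fintype.card V with hndef
  set S₀ := spiders G L with hS₀
  have hS₀m : ∀ p ∈ S₀, IsSpider G L p := fun p hp => mem_spiders.1 hp
  have hS₀card : n * δ ^ m ≤ 2 ^ m * #S₀ := le_card_spiders hδG hs m L rfl (by omega)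
  -- A restriction with `c` edges extends to at most Δ^(m-c) spiders, so positively many spiders
  -- have positively many restrictions.
  have hmany : ∀ (c r T : ℕ), c ≤ m → #S₀ ≤ 2 ^ Fintype.card ι * 2 * T →
      T ≤ r * Δ ^ (m - c) → n * δ ^ c ≤ A * r := by
    intro c r T hc hT hr
    have h1 : Δ ^ (m - c) ≤ K ^ m * δ ^ (m - c) := by
      calc Δ ^ (m - c) ≤ (K * δ) ^ (m - c) := Nat.pow_le_pow_left hKΔ _
        _ = K ^ (m - c) * δ ^ (m - c) := mul_pow _ _ _
        _ ≤ _ := Nat.mul_le_mul_right _ (Nat.pow_le_pow_right hK (by omega))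
    refine Nat.le_of_mul_le_mul_right (c := δ ^ (m - c)) ?_ (pow_pos hδpos _)
    calc n * δ ^ c * δ ^ (m - c) = n * δ ^ m := by
          rw [mul_assoc, ← pow_add, Nat.add_sub_cancel' hc]
      _ ≤ 2 ^ m * #S₀ := hS₀card
      _ ≤ 2 ^ m * (2 ^ Fintype.card ι * 2 * (r * (K ^ m * δ ^ (m - c)))) := by
          gcongr
          exact hT.trans (Nat.mul_le_mul_left _ (hr.trans (Nat.mul_le_mul_left _ h1)))
      _ = A * r * δ ^ (m - c) := by rw [hA]; ring
  let rank : ι → ℕ := fun o => o.elim (fun e => e.2.2) fun o =>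
    o.elim (fun _ => 0) fun j => k + 1 + ∑ i, (j i : ℕ)
  let P : ι → Finset (Fin s → ℕ → V) → Prop := fun o S => o.elim
    (fun e => 1 ≤ (e.2.2 : ℕ) → (e.2.1 : ℕ) + e.2.2 ≤ L e.1 →
      ∀ y x, #{q ∈ S.image (seg e.1 e.2.1 e.2.2) | q 0 = y ∧ q e.2.2 = x} ≤ F e.2.2)
    fun o => o.elim
      (fun e => e.1 ≠ e.2 → 2 ≤ k →
        ∀ y x, #{q ∈ S.image (bend e.1 e.2) | q 0 = y ∧ q 2 = x} ≤ F 0)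
      fun j => (∀ i, 1 ≤ (j i : ℕ)) → (∀ i, (j i : ℕ) ≤ L i) →
        ∀ v : Fin s → V, #{q ∈ S.image (trunc fun i => (j i : ℕ)) | ∀ i, q i (j i) = v i} ≤
          F (k + 1 + ∑ i, (j i : ℕ))
  have hPmono : ∀ i S T, S ⊆ T → P i T → P i S := by
    rintro (e | e | j) S T hST hT
    · exact fun h1 h2 y x => (card_le_card (filter_subset_filter _
        (image_subset_image hST))).trans (hT h1 h2 y x)
    · exact fun h1 h2 y x => (card_le_card (filter_subset_filter _
        (image_subset_image hST))).trans (hT h1 h2 y x)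
    · exact fun h1 h2 v => (card_le_card (filter_subset_filter _
        (image_subset_image hST))).trans (hT h1 h2 v)
  obtain ⟨S, hSS₀, hScard, hSP⟩ := exists_refinement rank P hPmono S₀ (by
    rintro o S hSS₀ hScard hlow
    have hSm : ∀ p ∈ S, IsSpider G L p := fun p hp => hS₀m p (hSS₀ hp)
    have hseg : ∀ i a l, 1 ≤ l → a + l ≤ L i → l < rank o → ∀ T ⊆ S, ∀ y x,
        #{q ∈ T.image (seg i a l) | q 0 = y ∧ q l = x} ≤ F l := by
      intro i a l hl hal hlo T hT y x
      have := hLk i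
      exact (card_le_card (filter_subset_filter _ (image_subset_image hT))).trans
        (hlow (Sum.inl (i, ⟨a, by omega⟩, ⟨l, by omega⟩)) hlo hl hal y x)
    have hTcard : ∀ T : Finset (Fin s → ℕ → V), #S ≤ 2 * #T → #S₀ ≤ 2 ^ Fintype.card ι * 2 * #T := fun T hT => by
      rw [mul_assoc]
      exact hScard.trans (Nat.mul_le_mul_left _ hT)
    rcases o with ⟨i, a, l⟩ | ⟨i, i'⟩ | j
    · change ∀ i' a' l', 1 ≤ l' → a' + l' ≤ L i' → l' < (l : ℕ) → _ at hseg
      change ∃ T ⊆ S, #S ≤ 2 * #T ∧ (1 ≤ (l : ℕ) → (a : ℕ) + l ≤ L i →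
        ∀ y x, #{q ∈ T.image (seg i a l) | q 0 = y ∧ q l = x} ≤ F l)
      by_cases hl : 1 ≤ (l : ℕ)
      swap
      · exact ⟨S, Subset.rfl, by omega, fun h => absurd h hl⟩
      by_cases hal : (a : ℕ) + l ≤ L i
      swap
      · exact ⟨S, Subset.rfl, by omega, fun _ h => absurd h hal⟩
      have hlL : (l : ℕ) ≤ m := by
        have : L i ≤ m := single_le_sum (f := L) (fun _ _ => Nat.zero_le _) (mem_univ i)
        omega
      have hlk : (l : ℕ) ≤ k := by omega
      by_cases hl1 : (l : ℕ) = 1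
      · refine ⟨S, Subset.rfl, by omega, fun _ _ y x => le_trans ?_ (hF1 _)⟩
        refine card_le_one.2 fun q hq q' hq' => ?_
        obtain ⟨hq, h0, h1⟩ := mem_filter.1 hq
        obtain ⟨p, hp, rfl⟩ := mem_image.1 hq
        obtain ⟨hq', h0', h1'⟩ := mem_filter.1 hq'
        obtain ⟨p', hp', rfl⟩ := mem_image.1 hq'
        rw [hl1] at h1 h1' ⊢
        rw [hl1] at h0 h0'
        funext e
        rcases Nat.eq_zero_or_pos e with rfl | he
        · rw [h0, h0']
        · have h2 := h1.trans h1'.symm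
          simpa only [seg, min_eq_right (Nat.succ_le_of_lt he), min_self] using h2
      obtain ⟨T, hTS, hT2, hT | hT⟩ := exists_rare_or_frequent (seg i a l)
        (fun q => (q 0, q (l : ℕ))) (F l) S
      · refine ⟨T, hTS, hT2, fun _ _ y x => ?_⟩
        simpa only [Prod.mk.injEq] using hT (y, x)
      · exfalso
        obtain ⟨r, hr⟩ : ∃ r, (l : ℕ) = r + 1 := ⟨l - 1, by omega⟩
        obtain ⟨x, hx⟩ := HP (F r ^ (s + 2)) G δ Δ l (T.image (seg i a l)) hn hΔ hKΔ
          ((hD r (by omega)).1.trans hδ) (by omega) hlk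
          (fun q hq => by
            obtain ⟨p, hp, rfl⟩ := mem_image.1 hq
            exact (hSm p (hTS hp)).isPathOn_seg hal)
          (fun q hq d => by
            obtain ⟨p, hp, rfl⟩ := mem_image.1 hq
            simp [seg])
          (hmany l _ #T hlL (hTcard T hT2)
            (card_le_card_image_seg_mul hΔ L i a l hal T fun p hp => hSm p (hTS hp)))
          (fun q hq => by
            have h1 := hT q hq
            simp only [Prod.mk.injEq] at h1
            refine lt_of_lt_of_le ?_ h1.le
            have h2 := hFs r
            rw [← hr] at h2
            omega)
          (fun d y x v hd hdl => by
            refine (card_seg_through_le T i a l d (F r) hdl.le ?_ ?_ y x v).trans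
              (hFpow r 2 (by omega))
            · exact fun y x => (hseg i a d hd (by omega) hdl T hTS y x).trans (hFmono (by omega))
            · exact fun y x => (hseg i (a + d) (l - d) (by omega) (by omega) (by omega) T hTS
                y x).trans (hFmono (by omega)))
        exact hrob x hx
    · change ∃ T ⊆ S, #S ≤ 2 * #T ∧ (i ≠ i' → 2 ≤ k →
        ∀ y x, #{q ∈ T.image (bend i i') | q 0 = y ∧ q 2 = x} ≤ F 0)
      by_cases hii : i = i'
      · exact ⟨S, Subset.rfl, by omega, fun h => absurd hii h⟩
      by_cases hk : 2 ≤ k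
      swap
      · exact ⟨S, Subset.rfl, by omega, fun _ h => absurd h hk⟩
      have h2m : 2 ≤ m := by
        calc 2 ≤ #(univ : Finset (Fin s)) := one_lt_card.2 ⟨i, mem_univ _, i', mem_univ _, hii⟩
          _ ≤ m := by simpa using hsm
      obtain ⟨T, hTS, hT2, hT | hT⟩ := exists_rare_or_frequent (bend i i')
        (fun q => (q 0, q 2)) (F 0) S
      · refine ⟨T, hTS, hT2, fun _ _ y x => ?_⟩
        simpa only [Prod.mk.injEq] using hT (y, x)
      · exfalso
        obtain ⟨x, hx⟩ := HP 1 G δ Δ 2 (T.image (bend i i')) hn hΔ hKΔ (by omega) le_rfl hk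
          (fun q hq => by
            obtain ⟨p, hp, rfl⟩ := mem_image.1 hq
            exact (hSm p (hTS hp)).isPathOn_bend hii hL1)
          (fun q hq d => by
            obtain ⟨p, hp, rfl⟩ := mem_image.1 hq
            rcases lt_or_ge d 2 with h | h
            · rw [min_eq_left h.le]
            · rw [min_eq_right h]
              simp only [bend]
              rw [if_neg (by omega), if_neg (by omega)]
              simp)
          (hmany 2 _ #T h2m (hTcard T hT2)
            (card_le_card_image_bend_mul hΔ L i i' hii hL1 T fun p hp => hSm p (hTS hp)))
          (fun q hq => by
            have h1 := hT q hq
            simp only [Prod.mk.injEq] at h1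
            refine lt_of_lt_of_le ?_ h1.le
            omega)
          (fun d y x v hd hdl => by
            refine card_le_one.2 fun q hq q' hq' => ?_
            obtain ⟨hq, h0, h2, h1⟩ := mem_filter.1 hq
            obtain ⟨p, hp, rfl⟩ := mem_image.1 hq
            obtain ⟨hq', h0', h2', h1'⟩ := mem_filter.1 hq'
            obtain ⟨p', hp', rfl⟩ := mem_image.1 hq'
            have hd1 : d = 1 := by omega
            subst hd1
            have e0 : p i 1 = p' i 1 := h0.trans h0'.symm
            have e1 : p i 0 = p' i 0 := h1.trans h1'.symm
            have e2 : p i' 1 = p' i' 1 := h2.trans h2'.symm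
            funext e
            simp only [bend, e0, e1, e2])
        exact hrob x hx
    · set jn : Fin s → ℕ := fun i => (j i : ℕ) with hjn
      change ∀ i' a' l', 1 ≤ l' → a' + l' ≤ L i' → l' < k + 1 + ∑ i, jn i → _ at hseg
      change ∃ T ⊆ S, #S ≤ 2 * #T ∧ ((∀ i, 1 ≤ jn i) → (∀ i, jn i ≤ L i) →
        ∀ v : Fin s → V, #{q ∈ T.image (trunc jn) | ∀ i, q i (jn i) = v i} ≤
          F (k + 1 + ∑ i, jn i))
      by_cases hj : ∀ i, 1 ≤ jn i
      swap
      · exact ⟨S, Subset.rfl, by omega, fun h => absurd h hj⟩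
      by_cases hjL : ∀ i, jn i ≤ L i
      swap
      · exact ⟨S, Subset.rfl, by omega, fun _ h => absurd h hjL⟩
      have hjm : ∑ i, jn i ≤ m := sum_le_sum fun i _ => hjL i
      have hjs : 1 ≤ ∑ i, jn i :=
        (hj ⟨0, hs⟩).trans (single_le_sum (f := jn) (fun _ _ => Nat.zero_le _) (mem_univ _))
      obtain ⟨r, hr⟩ : ∃ r, k + 1 + ∑ i, jn i = r + 1 := ⟨k + ∑ i, jn i, by omega⟩
      have hFr := hFs r
      rw [← hr] at hFr
      have hleg : ∀ T ⊆ S, ∀ i d, d < jn i → ∀ y x,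
          #{q ∈ T.image (seg i d (jn i - d)) | q 0 = y ∧ q (jn i - d) = x} ≤ F r := by
        intro T hTS i d hd y x
        have h1 := hjL i
        have h2 := hLk i
        exact (hseg i d (jn i - d) (by omega) (by omega) (by omega) T hTS y x).trans
          (hFmono (by omega))
      -- In the case of two legs of length 1, rarity already follows from smaller conditions and
      -- nothing is removed.
      by_cases hpair : 2 ≤ k ∧ ∃ i i', i ≠ i' ∧ jn i = 1 ∧ jn i' = 1
      · obtain ⟨hk, i, i', hii, hi, hi'⟩ := hpair
        refine ⟨S, Subset.rfl, by omega, fun _ _ v => ?_⟩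
        have hb := hlow (Sum.inr (Sum.inl (i, i'))) (by
          change 0 < k + 1 + ∑ i, jn i
          omega) hii hk
        refine (card_trunc_le_of_bend S hSm jn (F r) (fun i => hleg S Subset.rfl i 0 (hj i)) hi hi'
          (fun y x => (hb y x).trans (hFmono (Nat.zero_le _))) v).trans
          ((hFpow r (s + 1) (by omega)).trans (by omega))
      obtain ⟨T, hTS, hT2, hT | hT⟩ := exists_rare_or_frequent (trunc jn)
        (fun q i => q i (jn i)) (F (k + 1 + ∑ i, jn i)) S
      · refine ⟨T, hTS, hT2, fun _ _ v => ?_⟩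
        simpa only [funext_iff] using hT v
      · exfalso
        obtain ⟨S', hS'ne, hS'⟩ := HS (F r ^ (s + 2)) G δ Δ jn (T.image (trunc jn)) hn hΔ hKΔ
          ((hD r (by omega)).2.trans hδ) hj hjm
          (fun q hq => by
            obtain ⟨p, hp, rfl⟩ := mem_image.1 hq
            exact (hSm p (hTS hp)).trunc hjL)
          (hmany _ _ #T hjm (hTcard T hT2)
            (card_le_card_image_trunc_mul hΔ (m - ∑ i, jn i) jn L hjL (by omega) T
              fun p hp => hSm p (hTS hp)))
          (fun q hq => by
            have h1 := hT q hq
            simp only [funext_iff] at h1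
            refine lt_of_lt_of_le ?_ h1.le
            omega)
          (fun v i d u hd => by
            rcases Nat.eq_zero_or_pos d with rfl | h0
            · exact (card_trunc_through_center_le T (fun p hp => hSm p (hTS hp)) jn (F r)
                (fun i => hleg T hTS i 0 (hj i)) v i u).trans (hFpow r s (by omega))
            · refine (card_trunc_through_le T jn i d (F r) hd.le ?_ (hleg T hTS i d hd) v u).trans
                (hFpow r 2 (by omega))
              intro v
              have hup : ∀ a, Function.update jn i d a ≤ jn a := by
                intro a
                by_cases ha : a = i
                · subst ha; simpa using hd.le
                · simp [ha]
              have hlt : ∑ a, Function.update jn i d a < ∑ a, jn a :=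
                sum_lt_sum (fun a _ => hup a) ⟨i, mem_univ _, by simpa using hd⟩
              have h1 := hlow (Sum.inr (Sum.inr fun a => ⟨Function.update jn i d a,
                (hup a).trans_lt (j a).2⟩)) (by
                  change k + 1 + ∑ a, Function.update jn i d a < k + 1 + ∑ a, jn a
                  omega) (fun a => by
                  change 1 ≤ Function.update jn i d a
                  by_cases ha : a = i
                  · subst ha; rw [Function.update_self]; exact h0
                  · simpa [ha] using hj a) (fun a => (hup a).trans (hjL a)) v
              refine (card_le_card (filter_subset_filter _ (image_subset_image hTS))).trans
                (h1.trans (hFmono ?_))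
              change k + 1 + ∑ a, Function.update jn i d a ≤ r
              omega)
        -- The parity obstruction is absent: it needs either the excluded pair of legs or, for `k ≤
        -- 1`, a leg longer than `k`.
        obtain ⟨x, hx⟩ := hS'.exists_isRobust (N' := N) hs hS'ne hj hjL (by
          rintro i i' hii hi hi' ⟨h1, -⟩
          by_cases hk : 2 ≤ k
          · exact hpair ⟨hk, i, i', hii, hi, hi'⟩
          · have h2 := hLk i
            have h3 := h1.pos
            omega) le_rfl
        exact hrob x hx)
  -- The condition for `L` itself bounds the number of surviving spiders per tuple of leaves.
  have hfin := hSP (Sum.inr (Sum.inr fun i => ⟨L i, Nat.lt_succ_of_le (hLk i)⟩)) hL1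
    (fun i => le_rfl)
  have himg : S.image (trunc L) = S := by
    conv_rhs => rw [← image_id (s := S)]
    exact image_congr fun p hp => (hS₀m p (hSS₀ hp)).trunc_self
  change ∀ v : Fin s → V, #{q ∈ S.image (trunc L) | ∀ i, q i (L i) = v i} ≤ F (k + 1 + m) at hfin
  rw [himg] at hfin
  have h1 : #S ≤ F (k + 1 + m) * n ^ s := by
    refine (card_le_mul_card_image (f := fun (q : Fin s → ℕ → V) i => q i (L i)) S _
      fun v _ => ?_).trans (Nat.mul_le_mul_left _ ((card_le_univ _).trans (by simp [hndef])))
    simpa only [funext_iff] using hfin v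
  calc n * δ ^ m ≤ A * #S := hmany m #S #S le_rfl (hScard.trans (Nat.mul_le_mul_right _ (by omega)))
        (by simp)
    _ ≤ A * (F (k + 1 + m) * n ^ s) := Nat.mul_le_mul_left _ h1
    _ = _ := by ring

end ManyTuran

/-! ### The bound on the minimum degree -/

open ManyTuran in
theorem theorem1p9 (s t b k : ℕ) (hs : 2 ≤ s) (ht : 2 ≤ t) (hb : 1 ≤ b) (hbk : b ≤ k) :
    ∃ (n₀ : ℕ) (C : ℝ), 0 < n₀ ∧ 0 < C ∧
      ∀ n : ℕ, n₀ ≤ n →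
        ∀ (V : Type*) [Fintype V] (G : SimpleGraph V) [DecidableRel G.Adj],
          Fintype.card V = n →
          (ManyTuran.blownSpider s t b k).Free G →
          ManyTuran.IsAlmostRegular G (ManyTuran.regConst (ManyTuran.exponent s b k) : ℝ) →
          (G.minDegree : ℝ) < C * (n : ℝ) ^ ManyTuran.exponent s b k := by
  set K := regConst (exponent s b k) with hK
  -- `K + 1` is at least 1 without inspecting `regConst`. Robustness is required against as many
  -- vertices as `t` spiders have.
  obtain ⟨d₀, A, H⟩ := exists_card_mul_pow_le (s := s) (by omega) hb hbk (K + 1)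
    (t * (∑ i, lengthVector s b k i + 1)) (by omega)
  -- Since n^ε ≥ 1, this constant forces δ ≥ d₀ when the bound fails; being at least 1 and larger
  -- than `A`, its m-th power exceeds `A`.
  refine ⟨1, d₀ + A + 1, one_pos, by positivity, ?_⟩
  intro n hn V _ G _ hcard hfree hreg
  by_contra! hlt
  have hm : ∑ i, lengthVector s b k i = (s - 1) * k + b := by
    obtain ⟨s', rfl⟩ : ∃ s', s = s' + 1 := ⟨s - 1, by omega⟩
    exact sum_lengthVector s' b k
  have hs1 : ((s - 1 : ℕ) : ℝ) = (s : ℝ) - 1 := by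
    rw [Nat.cast_sub (by omega), Nat.cast_one]
  have hmpos : 0 < (s - 1) * k + b := by omega
  have hmR : (((s - 1) * k + b : ℕ) : ℝ) = ((s : ℝ) - 1) * k + b := by
    rw [← hs1]
    push_cast
    ring
  have hmR0 : (0 : ℝ) < ((s : ℝ) - 1) * k + b := by
    rw [← hmR]
    exact_mod_cast hmpos
  have hexp : exponent s b k * (((s - 1) * k + b : ℕ) : ℝ) = ((s - 1 : ℕ) : ℝ) := by
    rw [hmR, hs1, exponent, div_mul_cancel₀ _ hmR0.ne']
  have hexp0 : 0 ≤ exponent s b k := by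
    refine div_nonneg ?_ hmR0.le
    rw [← hs1]
    positivity
  have hnR : (1 : ℝ) ≤ n := by exact_mod_cast hn
  have hpow1 : 1 ≤ (n : ℝ) ^ exponent s b k := Real.one_le_rpow hnR hexp0
  have hδ : d₀ ≤ G.minDegree := by
    have h1 : (d₀ + A + 1 : ℝ) ≤ G.minDegree :=
      (le_mul_of_one_le_right (by positivity) hpow1).trans hlt
    have h2 : d₀ + A + 1 ≤ G.minDegree := by exact_mod_cast h1
    omega
  have hΔ : G.maxDegree ≤ (K + 1) * G.minDegree := by
    have h1 : G.maxDegree ≤ K * G.minDegree := by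
      unfold IsAlmostRegular at hreg
      exact_mod_cast hreg
    exact h1.trans (Nat.mul_le_mul_right _ (by omega))
  have hmain := H G G.minDegree G.maxDegree (by omega) G.minDegree_le_degree G.degree_le_maxDegree
    hΔ hδ (fun x hx => hfree (hx.isContained le_rfl (by omega) (by omega)
      (one_le_lengthVector hb hbk)))
  rw [hm, hcard] at hmain
  have hmainR : (n : ℝ) * (G.minDegree : ℝ) ^ ((s - 1) * k + b) ≤ A * (n : ℝ) ^ s := by
    exact_mod_cast hmain
  have hge : (d₀ + A + 1 : ℝ) * (n : ℝ) ^ (s - 1) ≤ (G.minDegree : ℝ) ^ ((s - 1) * k + b) := by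
    calc (d₀ + A + 1 : ℝ) * (n : ℝ) ^ (s - 1)
        ≤ (d₀ + A + 1 : ℝ) ^ ((s - 1) * k + b) * (n : ℝ) ^ (s - 1) := by
          gcongr
          refine le_self_pow₀ ?_ hmpos.ne'
          have : (0 : ℝ) ≤ d₀ + A := by positivity
          linarith
      _ = ((d₀ + A + 1 : ℝ) * (n : ℝ) ^ exponent s b k) ^ ((s - 1) * k + b) := by
          rw [mul_pow, ← Real.rpow_natCast ((n : ℝ) ^ exponent s b k), ← Real.rpow_mul (by positivity),
            hexp, Real.rpow_natCast]
      _ ≤ _ := by gcongr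
  have hns : (n : ℝ) ^ s = n * (n : ℝ) ^ (s - 1) := by
    rw [← pow_succ', Nat.sub_add_cancel (by omega)]
  have hnpos : (0 : ℝ) < n * (n : ℝ) ^ (s - 1) := by positivity
  rw [hns] at hmainR
  have hcon : (d₀ + A + 1 : ℝ) * (n * (n : ℝ) ^ (s - 1)) ≤ A * (n * (n : ℝ) ^ (s - 1)) := by
    calc (d₀ + A + 1 : ℝ) * (n * (n : ℝ) ^ (s - 1))
        = n * ((d₀ + A + 1 : ℝ) * (n : ℝ) ^ (s - 1)) := by ring
      _ ≤ n * (G.minDegree : ℝ) ^ ((s - 1) * k + b) := by gcongr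
      _ ≤ _ := hmainR
  have := le_of_mul_le_mul_right hcon hnpos
  have h0 : (0 : ℝ) ≤ d₀ := by positivity
  linarith
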